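/- Setting. Let $w_0,w_1\ge 0$ with $w_0+w_1=1$, and let $\rho_0,\rho_1\in C^1(\mathbb R)$ be probability densities on $\mathbb R$. Let $\nu$ be the law of $(X,Y)\in\mathbb R\times\{0,1\}$ with $\mathbb P(Y=y)=w_y$ and with $X$ having density $\rho_y$ conditionally on $Y=y$, and let $\nu^S$ be the image of $\nu$ under the exchange of the two labels. Assume: (ii) there are only finitely many $t\in\mathbb R$ with $w_0\rho_0(t)=w_1\rho_1(t)>0$; (iii) $w_0\rho_0'(t)\ne w_1\rho_1'(t)$ for every $t\in\mathbb R$ with $w_0\rho_0(t)=w_1\rho_1(t)>0$. Let $A_0\subseteq\mathbb R$ be (the set of) a Bayes classifier, i.e. $w_0\rho_0\le w_1\rho_1$ on $A_0$ and $w_1\rho_1\le w_0\rho_0$ on $\mathbb R\setminus A_0$, whose decision boundary lies where there is data: $w_0\rho_0(t)+w_1\rho_1(t)>0$ for every $t\in\partial A_0$. Notation. For $\varepsilon\ge0$ and Borel $A\subseteq\mathbb R$ the adversarial risk is $$R_\varepsilon(\mathbf 1_A)=\sup_{g}\ \nu\big(\{(x,y):\mathbf 1_A(g(x,y))\neq y\}\big),$$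 the supremum being over measurable $g:\mathbb R\times\{0,1\}\to\mathbb R$ with $|g(x,y)-x|\le\varepsilon$ for all $(x,y)$. Let $\tilde d_A(x)=d(x,A)$ for $x\notin A$ and $\tilde d_A(x)=-d(x,A^c)$ for $x\in A$ (with $d(x,\emptyset)=+\infty$), and $A^{s}=\{x:\tilde d_A(x)\le s\}$ for $s\in\mathbb R$. Let $c_\varepsilon((x_1,y_1),(x_2,y_2))=1$ if $|x_1-x_2|>2\varepsilon$ or $y_1\ne y_2$, and $0$ otherwise. $\Gamma(\nu,\nu^S)$ is the set of couplings of $\nu$ and $\nu^S$. Theorem. The interior of $A_0$ is a finite union $\bigcup_{i=1}^K(a_i(0),b_i(0))$ with $-\infty\le a_1(0)<b_1(0)<a_2(0)<\dots<a_K(0)<b_K(0)\le+\infty$ ($K=0$ being allowed), and there is $\varepsilon_0>0$ such that the following holds. The decoupled equations $$\frac{db_i}{d\varepsilon}=-\frac{w_0\rho_0'(b_i+\varepsilon)+w_1\rho_1'(b_i-\varepsilon)}{w_0\rho_0'(b_i+\varepsilon)-w_1\rho_1'(b_i-\varepsilon)},\qquad \frac{da_i}{d\varepsilon}=-\frac{w_1\rho_1'(a_i+\varepsilon)+w_0\rho_0'(a_i-\varepsilon)}{w_1\rho_1'(a_i+\varepsilon)-w_0\rho_0'(a_i-\varepsilon)}$$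 for the finite endpoints, with initial values $a_i(0)$, $b_i(0)$, have a solution on $[0,\varepsilon_0]$ along which the denominators do not vanish; infinite endpoints are kept infinite. For every such solution and every $\varepsilon\in[0,\varepsilon_0]$, the set $A^*_\varepsilon=\bigcup_{i=1}^K(a_i(\varepsilon),b_i(\varepsilon))$ satisfies: 1. there is a coupling $\pi_\varepsilon\in\Gamma(\nu,\nu^S)$ with $$w_1\int_{(A^*_\varepsilon)^{-\varepsilon}}\rho_1\,dx-w_0\int_{(A^*_\varepsilon)^{\varepsilon}}\rho_0\,dx=\frac12\int c_\varepsilon(z_1,z_2)\,d\pi_\varepsilon(z_1,z_2)+\frac12(w_1-w_0);$$ 2. $A^*_\varepsilon$ is a global minimizer of the adversarial risk: $R_\varepsilon(\mathbf 1_{A^*_\varepsilon})\le R_\varepsilon(\mathbf 1_B)$ for every Borel set $B\subseteq\mathbb R$. -/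

import Mathlib

open MeasureTheory Set
open scoped ENNReal

noncomputable section

namespace AdvClass

/-- A data point: a feature in `ℝ` together with a label in `{0, 1}`. -/
abbrev Datum : Type := ℝ × Fin 2

/-- `f` is a probability density with respect to Lebesgue measure on `ℝ`. -/
structure IsProbDensity (f : ℝ → ℝ) : Prop where
  nonneg : ∀ x, 0 ≤ f x
  integrable : Integrable f
  integral_eq_one : ∫ x, f x = 1

/-- The data distribution: label `y` has probability `w y`, and conditionally on the label `y`
the feature has density `ρ y`. -/
def dataMeasure (w : Fin 2 → ℝ) (ρ : Fin 2 → ℝ → ℝ) : Measure Datum :=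
  ∑ y : Fin 2, ENNReal.ofReal (w y) •
    (volume.withDensity (fun x => ENNReal.ofReal (ρ y x))).map (fun x => (x, y))

/-- The measure obtained by exchanging the two labels. -/
def swapLabels (ν : Measure Datum) : Measure Datum :=
  ν.map (fun z => (z.1, 1 - z.2))

/-- The couplings of `μ` and `ν`: probability measures with these first and second marginals. -/
def couplings (μ ν : Measure Datum) : Set (Measure (Datum × Datum)) :=
  {π | IsProbabilityMeasure π ∧ π.fst = μ ∧ π.snd = ν}

open Classical in
/-- The cost `c_ε`: the indicator of `{d(x₁, x₂) > 2 ε} ∪ {y₁ ≠ y₂}`. -/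
def transportCost (ε : ℝ) (z₁ z₂ : Datum) : ℝ :=
  if 2 * ε < dist z₁.1 z₂.1 ∨ z₁.2 ≠ z₂.2 then 1 else 0

open Classical in
/-- The signed distance to `A`, in the extended reals: the distance to the empty set is `+∞`. -/
def extSignedDist (A : Set ℝ) (x : ℝ) : EReal :=
  if x ∈ A then -((Metric.infEDist x Aᶜ : ℝ≥0∞) : EReal)
  else ((Metric.infEDist x A : ℝ≥0∞) : EReal)

/-- The set `A^s`: a dilation of `A` for `s > 0`, an erosion of `A` for `s < 0`. -/
def offsetSet (A : Set ℝ) (s : ℝ) : Set ℝ := {x | extSignedDist A x ≤ (s : EReal)}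

open Classical in
/-- The classifier `1_A`. -/
def classifier (A : Set ℝ) (x : ℝ) : Fin 2 := if x ∈ A then 1 else 0

/-- The 0-1 loss. -/
def zeroOneLoss (p y : Fin 2) : ℝ≥0∞ := if p ≠ y then 1 else 0

/-- The adversarial risk `R_ε(f)`: the supremum of the expected 0-1 loss over all (measurable)
perturbations `g(x, y)` of the feature by a distance at most `ε`. -/
def robustRisk (ν : Measure Datum) (ε : ℝ) (f : ℝ → Fin 2) : ℝ≥0∞ :=
  ⨆ (g : Datum → ℝ) (_ : Measurable g) (_ : ∀ z, dist (g z) z.1 ≤ ε),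
    ∫⁻ z, zeroOneLoss (f (g z)) z.2 ∂ν

/-- `A` is a solution of the robust classification problem: it minimizes `R_ε(1_B)` over all
Borel sets `B`. -/
def IsRobustOptimal (ν : Measure Datum) (ε : ℝ) (A : Set ℝ) : Prop :=
  MeasurableSet A ∧
    ∀ B : Set ℝ, MeasurableSet B → robustRisk ν ε (classifier A) ≤ robustRisk ν ε (classifier B)

/-- `1_A` is a Bayes classifier: it selects at every point a label whose weighted density is
largest (ties are broken arbitrarily). -/
def IsBayesSet (w : Fin 2 → ℝ) (ρ : Fin 2 → ℝ → ℝ) (A : Set ℝ) : Prop :=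
  ∀ x, (x ∈ A → w 0 * ρ 0 x ≤ w 1 * ρ 1 x) ∧ (x ∉ A → w 1 * ρ 1 x ≤ w 0 * ρ 0 x)

/-- The union of the open intervals `(a i, b i)` of the real line, with endpoints in `[-∞, +∞]`. -/
def intervalUnion {K : ℕ} (a b : Fin K → EReal) : Set ℝ :=
  {x | ∃ i, a i < (x : EReal) ∧ (x : EReal) < b i}

/-- `a` and `b` list, in increasing order `a₁ < b₁ < a₂ < ⋯ < a_K < b_K`, the endpoints of the
intervals that constitute `A` (up to boundary points). Given `A`, such a list is unique. -/
structure IsBoundary (A : Set ℝ) {K : ℕ} (a b : Fin K → EReal) : Prop where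
  lt : ∀ i, a i < b i
  lt_of_lt : ∀ i j, i < j → b i < a j
  union_eq : intervalUnion a b = interior A

/-- The trajectory `c` starts at `c₀` and, if `c₀` is finite, solves `dc/dε = - N(ε, c) / D(ε, c)`
on `[0, T]`, with a denominator that does not vanish along the trajectory. An infinite `c₀` does not
move. -/
def EndpointEvolves (N D : ℝ → ℝ → ℝ) (T : ℝ) (c₀ : EReal) (c : ℝ → EReal) : Prop :=
  ((c₀ = ⊥ ∨ c₀ = ⊤) ∧ ∀ ε ∈ Icc 0 T, c ε = c₀) ∨
  ∃ y : ℝ → ℝ, c₀ = (y 0 : EReal) ∧ (∀ ε ∈ Icc 0 T, c ε = (y ε : EReal)) ∧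
    ∀ ε ∈ Icc 0 T, D ε (y ε) ≠ 0 ∧
      HasDerivWithinAt y (-(N ε (y ε) / D ε (y ε))) (Icc 0 T) ε

/-- The endpoints `a i`, `b i` solve on `[0, T]` the decoupled evolution equations with initial
values `a₀ i`, `b₀ i`. -/
def SolvesEvolution (w : Fin 2 → ℝ) (ρ : Fin 2 → ℝ → ℝ) (T : ℝ) {K : ℕ}
    (a₀ b₀ : Fin K → EReal) (a b : Fin K → ℝ → EReal) : Prop :=
  ∀ i,
    EndpointEvolves
      (fun ε t => w 1 * deriv (ρ 1) (t + ε) + w 0 * deriv (ρ 0) (t - ε))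
      (fun ε t => w 1 * deriv (ρ 1) (t + ε) - w 0 * deriv (ρ 0) (t - ε))
      T (a₀ i) (a i) ∧
    EndpointEvolves
      (fun ε t => w 0 * deriv (ρ 0) (t + ε) + w 1 * deriv (ρ 1) (t - ε))
      (fun ε t => w 0 * deriv (ρ 0) (t + ε) - w 1 * deriv (ρ 1) (t - ε))
      T (b₀ i) (b i)

end AdvClass

end

open AdvClass

/-!
Near a finite endpoint the weighted densities `f = w₀ρ₀` and `g = w₁ρ₁` cross transversally, and the
evolution equation says that `g (c + ε) = f (c - ε)` is preserved. Hence there is a small window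
around the endpoint in which `f` has as much mass to the left of `c - ε` as `g` has to the left of
`c + ε`, and likewise on the right. The monotone coupling of `f` and `g` on the window therefore
moves `c - ε` to `c + ε`, and the ordering of the densities on either side makes this the largest
displacement. Off the windows one keeps `min f g` on the diagonal. The resulting matching of the two
classes has as much mass as an adversary of budget `ε` can take from the evolved classifier. Used in
both directions and completed arbitrarily, it becomes a coupling of the data with its label swap.

Optimality is weak duality: if `z₁` has cost zero against the label swap of `z₂`, the midpoint of
the two features receives a single label, so any classifier is attacked successfully at one of them.
-/

noncomputable section

namespace AdvClass

open Filter Topology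

/-! ### Monotone couplings on the real line -/

/-- `σ` is a coupling of `μ` and `ν` that moves almost every point by at most `η`. -/
structure IsShortCoupling {X : Type*} [MeasurableSpace X] [Dist X] (μ ν : Measure X) (η : ℝ)
    (σ : Measure (X × X)) : Prop where
  fst_eq : σ.fst = μ
  snd_eq : σ.snd = ν
  ae_dist_le : ∀ᵐ z ∂σ, dist z.1 z.2 ≤ η

/-- The quantile function of a finite measure on the real line, parametrized by `(0, μ univ)`. -/
def quantile (μ : Measure ℝ) (u : ℝ) : ℝ := sInf {x | ENNReal.ofReal u ≤ μ (Iic x)}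

section Quantile

variable (μ ν : Measure ℝ) [IsFiniteMeasure μ] [IsFiniteMeasure ν]

theorem tendsto_measure_Iic_atBot : Tendsto (fun x => μ (Iic x)) atBot (𝓝 0) := by
  have h := tendsto_measure_iInter_atBot (μ := μ) (s := fun x : ℝ => Iic x)
    (fun _ => measurableSet_Iic.nullMeasurableSet) (fun _ _ h => Iic_subset_Iic.2 h)
    ⟨0, measure_ne_top _ _⟩
  rwa [iInter_Iic_eq_empty_iff.2 (by simp), measure_empty] at h

theorem tendsto_measure_Iic_nhdsGT (x : ℝ) :
    Tendsto (fun y => μ (Iic y)) (𝓝[>] x) (𝓝 (μ (Iic x))) := by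
  have h := tendsto_measure_biInter_gt (μ := μ) (s := fun x : ℝ => Iic x) (a := x)
    (fun _ _ => measurableSet_Iic.nullMeasurableSet) (fun _ _ _ h => Iic_subset_Iic.2 h)
    ⟨x + 1, by simp, measure_ne_top _ _⟩
  have hinter : ⋂ r > x, Iic r = Iic x := by
    ext y
    simp only [mem_iInter, mem_Iic]
    exact ⟨le_of_forall_gt_imp_ge_of_dense, fun h r hr => h.trans hr.le⟩
  rwa [hinter] at h

theorem bddBelow_setOf_ofReal_le_measure_Iic {u : ℝ} (hu : 0 < u) :
    BddBelow {x | ENNReal.ofReal u ≤ μ (Iic x)} := by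
  obtain ⟨y, hy⟩ := ((tendsto_measure_Iic_atBot μ).eventually_lt_const
    (ENNReal.ofReal_pos.2 hu)).exists
  refine ⟨y, fun z hz => le_of_not_gt fun hzy => hy.not_ge ?_⟩
  exact hz.trans (measure_mono (Iic_subset_Iic.2 hzy.le))

theorem nonempty_setOf_ofReal_le_measure_Iic {u : ℝ} (hu : u < μ.real univ) :
    {x | ENNReal.ofReal u ≤ μ (Iic x)}.Nonempty := by
  rcases le_or_gt u 0 with hu₀ | hu₀
  · exact ⟨0, by simp [ENNReal.ofReal_of_nonpos hu₀]⟩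
  have hlt : ENNReal.ofReal u < μ univ := by
    rw [← ofReal_measureReal (measure_ne_top μ univ)]
    exact (ENNReal.ofReal_lt_ofReal_iff (hu₀.trans hu)).2 hu
  obtain ⟨y, hy⟩ := ((tendsto_measure_Iic_atTop μ).eventually_const_lt hlt).exists
  exact ⟨y, hy.le⟩

theorem quantile_le_iff {u x : ℝ} (hu : u ∈ Ioo 0 (μ.real univ)) :
    quantile μ u ≤ x ↔ ENNReal.ofReal u ≤ μ (Iic x) := by
  refine ⟨fun h => ?_, fun h => csInf_le (bddBelow_setOf_ofReal_le_measure_Iic μ hu.1) h⟩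
  refine ge_of_tendsto (tendsto_measure_Iic_nhdsGT μ x) ?_
  filter_upwards [self_mem_nhdsWithin] with y hy
  obtain ⟨s, hs, hsy⟩ := exists_lt_of_csInf_lt (nonempty_setOf_ofReal_le_measure_Iic μ hu.2)
    (lt_of_le_of_lt h hy)
  exact hs.trans (measure_mono (Iic_subset_Iic.2 hsy.le))

theorem ofReal_le_measure_Iic_quantile {u : ℝ} (hu : u ∈ Ioo 0 (μ.real univ)) :
    ENNReal.ofReal u ≤ μ (Iic (quantile μ u)) :=
  (quantile_le_iff μ hu).1 le_rfl

theorem aemeasurable_quantile :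
    AEMeasurable (quantile μ) (volume.restrict (Ioo 0 (μ.real univ))) := by
  refine aemeasurable_restrict_of_monotoneOn measurableSet_Ioo fun u hu v hv huv => ?_
  rw [quantile_le_iff μ hu]
  exact (ENNReal.ofReal_le_ofReal huv).trans (ofReal_le_measure_Iic_quantile μ hv)

theorem map_quantile : (volume.restrict (Ioo 0 (μ.real univ))).map (quantile μ) = μ := by
  refine Measure.ext_of_Iic _ _ fun x => ?_
  have hpreimage : quantile μ ⁻¹' Iic x =ᵐ[volume.restrict (Ioo 0 (μ.real univ))]
      Iic (μ.real (Iic x)) := by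
    filter_upwards [ae_restrict_mem measurableSet_Ioo] with u hu
    exact propext ((quantile_le_iff μ hu).trans
      (ENNReal.ofReal_le_iff_le_toReal (measure_ne_top _ _)))
  have hinter : (Iic (μ.real (Iic x)) ∩ Ioo 0 (μ.real univ) : Set ℝ) =ᵐ[volume]
      Ioc 0 (μ.real (Iic x)) := by
    filter_upwards [volume.ae_ne (μ.real univ)] with u hu
    have hle : μ.real (Iic x) ≤ μ.real univ := measureReal_mono (subset_univ _)
    exact propext ⟨fun h => ⟨h.2.1, h.1⟩, fun h => ⟨h.2, h.1, (h.2.trans hle).lt_of_ne hu⟩⟩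
  rw [Measure.map_apply_of_aemeasurable (aemeasurable_quantile μ) measurableSet_Iic,
    measure_congr hpreimage, Measure.restrict_apply measurableSet_Iic, measure_congr hinter,
    Real.volume_Ioc, sub_zero, ofReal_measureReal]

theorem exists_isShortCoupling_of_measure_Iic_le {η : ℝ} (hmass : μ univ = ν univ)
    (hle : ∀ x, ν (Iic x) ≤ μ (Iic x)) (hle_add : ∀ x, μ (Iic x) ≤ ν (Iic (x + η))) :
    ∃ σ, IsShortCoupling μ ν η σ := by
  have hreal : ν.real univ = μ.real univ := by simp [measureReal_def, hmass]
  set P := volume.restrict (Ioo 0 (μ.real univ))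
  have hμ : AEMeasurable (quantile μ) P := aemeasurable_quantile μ
  have hν : AEMeasurable (quantile ν) P := by simpa only [hreal] using aemeasurable_quantile ν
  refine ⟨P.map fun u => (quantile μ u, quantile ν u), ?_, ?_, ?_⟩
  · rw [Measure.fst, AEMeasurable.map_map_of_aemeasurable measurable_fst.aemeasurable
      (hμ.prodMk hν)]
    exact map_quantile μ
  · rw [Measure.snd, AEMeasurable.map_map_of_aemeasurable measurable_snd.aemeasurable
      (hμ.prodMk hν)]
    have hmap := map_quantile ν
    rwa [hreal] at hmap
  · rw [ae_map_iff (hμ.prodMk hν) (measurableSet_le (by fun_prop) (by fun_prop))]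
    filter_upwards [ae_restrict_mem measurableSet_Ioo] with u hu
    have hu' : u ∈ Ioo 0 (ν.real univ) := hreal ▸ hu
    have hquantile_le : quantile μ u ≤ quantile ν u :=
      (quantile_le_iff μ hu).2 ((ofReal_le_measure_Iic_quantile ν hu').trans (hle _))
    have hle_quantile_add : quantile ν u ≤ quantile μ u + η :=
      (quantile_le_iff ν hu').2 ((ofReal_le_measure_Iic_quantile μ hu).trans (hle_add _))
    rw [Real.dist_eq, abs_sub_comm, abs_of_nonneg (by linarith)]
    linarith

end Quantile

/-! ### Thickenings of subsets of the real line -/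

theorem countable_cthickening_diff_thickening (S : Set ℝ) {ε : ℝ} (hε : 0 < ε) :
    (Metric.cthickening ε S \ Metric.thickening ε S).Countable := by
  set D := Metric.cthickening ε S \ Metric.thickening ε S
  have hsubset : D ⊆ {x ∈ D | 𝓝[D ∩ Ioi x] x = ⊥} ∪ {x ∈ D | 𝓝[D ∩ Iio x] x = ⊥} := by
    intro x hx
    obtain ⟨p, hp, hxp⟩ : ∃ p ∈ closure S, x ∈ Metric.closedBall p ε := by
      simpa only [Metric.cthickening_eq_biUnion_closedBall S hε.le, mem_iUnion, exists_prop]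
        using hx.1
    have hball : ∀ z, |z - p| < ε → z ∉ D := fun z hz hzD => hzD.2 <| by
      rw [← Metric.thickening_closure]
      exact Metric.mem_thickening_iff.2 ⟨p, hp, hz⟩
    have hdist : |x - p| = ε := le_antisymm hxp (not_lt.1 fun h => hball x h hx)
    rcases (abs_eq hε.le).1 hdist with h | h
    · refine Or.inr ⟨hx, eventually_false_iff_eq_bot.1 (eventually_nhdsWithin_iff.2 ?_)⟩
      filter_upwards [Ioi_mem_nhds (show p < x by linarith)] with z (hz : p < z) hzD
      exact hball z (abs_lt.2 ⟨by linarith, by linarith [mem_Iio.1 hzD.2]⟩) hzD.1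
    · refine Or.inl ⟨hx, eventually_false_iff_eq_bot.1 (eventually_nhdsWithin_iff.2 ?_)⟩
      filter_upwards [Iio_mem_nhds (show x < p by linarith)] with z (hz : z < p) hzD
      exact hball z (abs_lt.2 ⟨by linarith [mem_Ioi.1 hzD.2], by linarith⟩) hzD.1
  exact (countable_setOfPred_isolated_right_within.union
    countable_setOfPred_isolated_left_within).mono hsubset

theorem thickening_ae_eq_cthickening (S : Set ℝ) {ε : ℝ} (hε : 0 < ε) :
    Metric.thickening ε S =ᵐ[volume] Metric.cthickening ε S :=
  (Metric.thickening_subset_cthickening ε S).eventuallyLE.antisymm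
    (ae_le_set.2 ((countable_cthickening_diff_thickening S hε).measure_zero volume))

theorem exists_measurable_forall_mem_thickening {X : Type*} [PseudoMetricSpace X]
    [SecondCountableTopology X] [MeasurableSpace X] [OpensMeasurableSpace X] (S : Set X) {ε : ℝ}
    (hε : 0 ≤ ε) : ∃ g : X → X, Measurable g ∧ (∀ x, dist (g x) x ≤ ε) ∧
      ∀ x ∈ Metric.thickening ε S, g x ∈ S := by
  classical
  rcases S.eq_empty_or_nonempty with rfl | hne
  · exact ⟨id, measurable_id, by simp [hε], by simp⟩
  have := hne.to_subtype
  set d : ℕ → X := fun n => TopologicalSpace.denseSeq S n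
  have hex : ∀ x, ∃ n, x ∈ Metric.thickening ε S → dist x (d n) < ε := by
    intro x
    by_cases hx : x ∈ Metric.thickening ε S
    · obtain ⟨b, hb, hxb⟩ := Metric.mem_thickening_iff.1 hx
      obtain ⟨n, hn⟩ := (TopologicalSpace.denseRange_denseSeq S).exists_mem_open
        (s := {c : S | dist x c < ε}) (isOpen_lt (by fun_prop) continuous_const) ⟨⟨b, hb⟩, hxb⟩
      exact ⟨n, fun _ => hn⟩
    · exact ⟨0, fun h => absurd h hx⟩
  have hT : MeasurableSet (Metric.thickening ε S) := Metric.isOpen_thickening.measurableSet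
  refine ⟨fun x => if x ∈ Metric.thickening ε S then d (Nat.find (hex x)) else x, ?_,
    fun x => ?_, fun x hx => ?_⟩
  · refine Measurable.ite hT (Measurable.find (fun n => measurable_const) (fun n => ?_) hex)
      measurable_id
    exact hT.imp (measurableSet_lt (by fun_prop) measurable_const)
  · dsimp only
    split_ifs with hx
    · rw [dist_comm]
      exact (Nat.find_spec (hex x) hx).le
    · simpa using hε
  · simp only [if_pos hx]
    exact Subtype.coe_prop _

theorem exists_measurable_ae_mem_of_dist_le (S : Set ℝ) {ε : ℝ} (hε : 0 ≤ ε) :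
    ∃ g : ℝ → ℝ, Measurable g ∧ (∀ x, dist (g x) x ≤ ε) ∧
      ∀ᵐ x, (∃ b ∈ S, dist x b ≤ ε) → g x ∈ S := by
  rcases hε.eq_or_lt with rfl | hε
  · refine ⟨id, measurable_id, by simp, ae_of_all _ ?_⟩
    rintro x ⟨b, hb, hxb⟩
    rwa [id, dist_le_zero.1 hxb]
  · obtain ⟨g, hg, hdist, hmem⟩ := exists_measurable_forall_mem_thickening S hε.le
    refine ⟨g, hg, hdist, ?_⟩
    filter_upwards [(thickening_ae_eq_cthickening S hε).mem_iff] with x hx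
    rintro ⟨b, hb, hxb⟩
    exact hmem x (hx.2 (Metric.mem_cthickening_of_dist_le x b ε S hb hxb))

/-! ### Measures on labelled data -/

/-- The measure on labelled data whose restriction to the label `y` is `μ y`. -/
def labelMeasure (μ : Fin 2 → Measure ℝ) : Measure Datum := ∑ y : Fin 2, (μ y).map fun x => (x, y)

/-- The exchange of the two labels, under which `swapLabels` is the push-forward. -/
def labelSwap (z : Datum) : Datum := (z.1, 1 - z.2)

theorem labelSwap_involutive : Function.Involutive labelSwap := fun z => by
  simp [labelSwap]

theorem measurable_labelSwap : Measurable labelSwap :=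
  measurable_fst.prodMk (measurable_of_finite (fun y : Fin 2 => 1 - y) |>.comp measurable_snd)

theorem swapLabels_eq_map (ν : Measure Datum) : swapLabels ν = ν.map labelSwap := rfl

theorem labelMeasure_apply (μ : Fin 2 → Measure ℝ) (s : Set Datum) :
    labelMeasure μ s = μ 0 {x | (x, 0) ∈ s} + μ 1 {x | (x, 1) ∈ s} := by
  rw [labelMeasure, Fin.sum_univ_two, Measure.add_apply,
    (measurableEmbedding_prod_mk_right 0).map_apply,
    (measurableEmbedding_prod_mk_right 1).map_apply]
  rfl

theorem labelMeasure_mono {μ ν : Fin 2 → Measure ℝ} (h : μ ≤ ν) :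
    labelMeasure μ ≤ labelMeasure ν := Measure.le_iff.2 fun s _ => by
  rw [labelMeasure_apply, labelMeasure_apply]
  exact add_le_add (h 0 _) (h 1 _)

theorem swapLabels_labelMeasure (μ : Fin 2 → Measure ℝ) :
    swapLabels (labelMeasure μ) = labelMeasure fun y => μ (1 - y) := by
  ext s hs
  rw [swapLabels_eq_map, Measure.map_apply measurable_labelSwap hs, labelMeasure_apply,
    labelMeasure_apply, add_comm]
  rfl

theorem map_labelSwap_swapLabels (ν : Measure Datum) : (swapLabels ν).map labelSwap = ν := by
  rw [swapLabels_eq_map, Measure.map_map measurable_labelSwap measurable_labelSwap,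
    labelSwap_involutive.comp_self, Measure.map_id]

theorem fst_labelMeasure (μ : Fin 2 → Measure ℝ) : (labelMeasure μ).fst = μ 0 + μ 1 := by
  ext s hs
  rw [Measure.fst_apply hs, labelMeasure_apply]
  rfl

/-! ### The adversarial risk and weak duality -/

/-- The data points that some perturbation of size at most `ε` makes the classifier `1_B`
misclassify. -/
def vulnerableSet (B : Set ℝ) (ε : ℝ) : Set Datum :=
  {z | ∃ b, dist z.1 b ≤ ε ∧ classifier B b ≠ z.2}

/-- The pairs of data points whose transport cost `c_ε` is `1`. -/
def costlySet (ε : ℝ) : Set (Datum × Datum) :=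
  {z | 2 * ε < dist z.1.1 z.2.1 ∨ z.1.2 ≠ z.2.2}

theorem measurableSet_costlySet (ε : ℝ) : MeasurableSet (costlySet ε) :=
  (measurableSet_lt measurable_const
    ((measurable_fst.comp measurable_fst).dist (measurable_fst.comp measurable_snd))).union
    (measurableSet_eq_fun (measurable_snd.comp measurable_fst)
      (measurable_snd.comp measurable_snd)).compl

theorem integral_transportCost (ε : ℝ) (π : Measure (Datum × Datum)) :
    ∫ z, transportCost ε z.1 z.2 ∂π = π.real (costlySet ε) := by
  rw [← integral_indicator_one (measurableSet_costlySet ε)]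
  refine integral_congr_ae (ae_of_all _ fun z => ?_)
  by_cases hz : 2 * ε < dist z.1.1 z.2.1 ∨ z.1.2 ≠ z.2.2 <;>
    simp [transportCost, indicator, costlySet, hz]

theorem measurable_classifier {A : Set ℝ} (hA : MeasurableSet A) : Measurable (classifier A) := by
  classical
  exact Measurable.ite hA measurable_const measurable_const

theorem classifier_ne_zero_iff {A : Set ℝ} {x : ℝ} : classifier A x ≠ 0 ↔ x ∈ A := by
  simp [classifier]

theorem classifier_ne_one_iff {A : Set ℝ} {x : ℝ} : classifier A x ≠ 1 ↔ x ∈ Aᶜ := by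
  simp [classifier]

theorem lintegral_zeroOneLoss (ν : Measure Datum) {p : Datum → Fin 2} (hp : Measurable p) :
    ∫⁻ z, zeroOneLoss (p z) z.2 ∂ν = ν {z | p z ≠ z.2} := by
  have hmeas : MeasurableSet {z | p z ≠ z.2} := (measurableSet_eq_fun hp measurable_snd).compl
  rw [← lintegral_indicator_one hmeas]
  refine lintegral_congr fun z => ?_
  by_cases hz : p z = z.2 <;> simp [zeroOneLoss, hz]

theorem robustRisk_le_measure_vulnerableSet (ν : Measure Datum) (ε : ℝ) {B : Set ℝ}
    (hB : MeasurableSet B) :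
    robustRisk ν ε (classifier B) ≤ ν (vulnerableSet B ε) := by
  refine iSup_le fun g => iSup_le fun hg => iSup_le fun hdist => ?_
  refine (lintegral_zeroOneLoss ν ((measurable_classifier hB).comp hg)).trans_le ?_
  exact measure_mono fun z hz => ⟨g z, by rw [dist_comm]; exact hdist z, hz⟩

theorem measure_vulnerableSet_le_robustRisk {ν : Measure Datum} (hν : ν.fst ≪ volume) {ε : ℝ}
    (hε : 0 ≤ ε) {B : Set ℝ} (hB : MeasurableSet B) :
    ν (vulnerableSet B ε) ≤ robustRisk ν ε (classifier B) := by
  choose g hg hdist hmem using fun y =>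
    exists_measurable_ae_mem_of_dist_le {b | classifier B b ≠ y} hε
  have hattack : Measurable fun z : Datum => g z.2 z.1 :=
    measurable_from_prod_countable_left hg
  have hae : vulnerableSet B ε ≤ᵐ[ν] {z | classifier B (g z.2 z.1) ≠ z.2} := by
    filter_upwards [ae_of_ae_map measurable_fst.aemeasurable (hν.ae_le (ae_all_iff.2 hmem))]
      with z hz
    rintro ⟨b, hzb, hb⟩
    exact hz z.2 ⟨b, hb, hzb⟩
  calc ν (vulnerableSet B ε) ≤ ν {z | classifier B (g z.2 z.1) ≠ z.2} := measure_mono_ae hae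
    _ = ∫⁻ z, zeroOneLoss (classifier B (g z.2 z.1)) z.2 ∂ν :=
      (lintegral_zeroOneLoss ν ((measurable_classifier hB).comp hattack)).symm
    _ ≤ robustRisk ν ε (classifier B) :=
      le_iSup_of_le (fun z => g z.2 z.1) (le_iSup_of_le hattack
        (le_iSup_of_le (fun z => hdist z.2 z.1) le_rfl))

/-- The adversary can move both features to their midpoint, whose predicted label is wrong for one
of the labels `y` and `1 - y`. -/
theorem mem_vulnerableSet_or_of_notMem_costlySet (B : Set ℝ) {ε : ℝ} {z : Datum × Datum}
    (hz : z ∉ costlySet ε) : z.1 ∈ vulnerableSet B ε ∨ labelSwap z.2 ∈ vulnerableSet B ε := by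
  obtain ⟨hdist, hlabel⟩ : dist z.1.1 z.2.1 ≤ 2 * ε ∧ z.1.2 = z.2.2 := by
    simpa [costlySet] using hz
  set m := midpoint ℝ z.1.1 z.2.1
  by_cases hm : classifier B m = z.1.2
  · refine Or.inr ⟨m, ?_, ?_⟩
    · rw [labelSwap, dist_right_midpoint, Real.norm_ofNat]
      linarith
    · rw [hm, hlabel]
      have : ∀ y : Fin 2, y ≠ 1 - y := by decide
      exact this _
  · refine Or.inl ⟨m, ?_, hm⟩
    rw [dist_left_midpoint, Real.norm_ofNat]
    linarith

theorem one_le_two_mul_measure_vulnerableSet_add {ν : Measure Datum} (B : Set ℝ) (ε : ℝ)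
    {π : Measure (Datum × Datum)} (hπ : π ∈ couplings ν (swapLabels ν)) :
    1 ≤ 2 * ν (vulnerableSet B ε) + π (costlySet ε) := by
  obtain ⟨hprob, hfst, hsnd⟩ := hπ
  have hcover : univ ⊆ Prod.fst ⁻¹' vulnerableSet B ε ∪
      Prod.snd ⁻¹' (labelSwap ⁻¹' vulnerableSet B ε) ∪ costlySet ε := fun z _ => by
    by_cases hz : z ∈ costlySet ε
    · exact Or.inr hz
    · exact Or.inl (mem_vulnerableSet_or_of_notMem_costlySet B hz)
  have hle_fst : π (Prod.fst ⁻¹' vulnerableSet B ε) ≤ ν (vulnerableSet B ε) := by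
    rw [← hfst]
    exact Measure.le_map_apply measurable_fst.aemeasurable _
  have hle_snd : π (Prod.snd ⁻¹' (labelSwap ⁻¹' vulnerableSet B ε)) ≤ ν (vulnerableSet B ε) :=
    calc π (Prod.snd ⁻¹' (labelSwap ⁻¹' vulnerableSet B ε))
        ≤ π.snd (labelSwap ⁻¹' vulnerableSet B ε) :=
          Measure.le_map_apply measurable_snd.aemeasurable _
      _ ≤ π.snd.map labelSwap (vulnerableSet B ε) :=
          Measure.le_map_apply measurable_labelSwap.aemeasurable _
      _ = ν (vulnerableSet B ε) := by rw [hsnd, map_labelSwap_swapLabels]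
  calc 1 = π univ := measure_univ.symm
    _ ≤ π (Prod.fst ⁻¹' vulnerableSet B ε) +
        π (Prod.snd ⁻¹' (labelSwap ⁻¹' vulnerableSet B ε)) + π (costlySet ε) :=
      (measure_mono hcover).trans ((measure_union_le _ _).trans
        (add_le_add_left (measure_union_le _ _) _))
    _ ≤ 2 * ν (vulnerableSet B ε) + π (costlySet ε) := by
      rw [two_mul]
      gcongr

theorem one_le_two_mul_robustRisk_add {ν : Measure Datum} (hν : ν.fst ≪ volume) {ε : ℝ}
    (hε : 0 ≤ ε) {π : Measure (Datum × Datum)} (hπ : π ∈ couplings ν (swapLabels ν)) {B : Set ℝ}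
    (hB : MeasurableSet B) :
    1 ≤ 2 * robustRisk ν ε (classifier B) + π (costlySet ε) := by
  refine (one_le_two_mul_measure_vulnerableSet_add B ε hπ).trans ?_
  gcongr
  exact measure_vulnerableSet_le_robustRisk hν hε hB

theorem offsetSet_of_nonneg (A : Set ℝ) {ε : ℝ} (hε : 0 ≤ ε) :
    offsetSet A ε = Metric.cthickening ε A := by
  ext x
  have hcoe : ((ENNReal.ofReal ε : ℝ≥0∞) : EReal) = ε := by
    rw [EReal.coe_ennreal_ofReal, max_eq_left hε]
  rw [offsetSet, mem_ofPred_eq, extSignedDist, Metric.mem_cthickening_iff]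
  split_ifs with hx
  · simp only [Metric.infEDist_zero_of_mem hx, zero_le, iff_true]
    exact (EReal.neg_le_zero.2 (EReal.coe_ennreal_nonneg _)).trans (EReal.coe_nonneg.2 hε)
  · rw [← hcoe, EReal.coe_ennreal_le_coe_ennreal_iff]

theorem offsetSet_neg_of_pos (A : Set ℝ) {ε : ℝ} (hε : 0 < ε) :
    offsetSet A (-ε) = (Metric.thickening ε Aᶜ)ᶜ := by
  ext x
  have hcoe : ((ENNReal.ofReal ε : ℝ≥0∞) : EReal) = ε := by
    rw [EReal.coe_ennreal_ofReal, max_eq_left hε.le]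
  rw [offsetSet, mem_ofPred_eq, extSignedDist, mem_compl_iff, Metric.mem_thickening_iff_infEDist_lt,
    not_lt]
  split_ifs with hx
  · rw [EReal.coe_neg, EReal.neg_le_neg_iff, ← hcoe, EReal.coe_ennreal_le_coe_ennreal_iff]
  · simp only [Metric.infEDist_zero_of_mem (mem_compl hx), nonpos_iff_eq_zero,
      ENNReal.ofReal_eq_zero, hε.not_ge, iff_false, not_le]
    exact (EReal.coe_neg'.2 (neg_lt_zero.2 hε)).trans_le (EReal.coe_ennreal_nonneg _)

theorem compl_offsetSet_neg_ae_eq {A : Set ℝ} (hA : volume (frontier A) = 0) {ε : ℝ}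
    (hε : 0 ≤ ε) : ((offsetSet A (-ε))ᶜ : Set ℝ) =ᵐ[volume] Metric.cthickening ε Aᶜ := by
  rcases hε.eq_or_lt with rfl | hε
  · rw [neg_zero, offsetSet_of_nonneg A le_rfl, Metric.cthickening_zero, Metric.cthickening_zero,
      ← interior_compl]
    refine (interior_subset_closure.eventuallyLE).antisymm (ae_le_set.2 ?_)
    rwa [← frontier_compl] at hA
  · rw [offsetSet_neg_of_pos A hε, compl_compl]
    exact thickening_ae_eq_cthickening Aᶜ hε

theorem measure_vulnerableSet_le (μ : Fin 2 → Measure ℝ) (hμ : μ 1 ≪ volume) {ε : ℝ}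
    (hε : 0 ≤ ε) {A : Set ℝ} (hA : volume (frontier A) = 0) :
    labelMeasure μ (vulnerableSet A ε) ≤ μ 0 (offsetSet A ε) + μ 1 (offsetSet A (-ε))ᶜ := by
  rw [labelMeasure_apply, measure_congr (hμ.ae_le (compl_offsetSet_neg_ae_eq hA hε)),
    offsetSet_of_nonneg A hε]
  gcongr
  · rintro x ⟨b, hxb, hb⟩
    exact Metric.mem_cthickening_of_dist_le x b ε A (classifier_ne_zero_iff.1 hb) hxb
  · rintro x ⟨b, hxb, hb⟩
    exact Metric.mem_cthickening_of_dist_le x b ε Aᶜ (classifier_ne_one_iff.1 hb) hxb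

/-! ### Completion of a partial matching of the two classes -/

theorem exists_measure_fst_eq_snd_eq {α β : Type*} [MeasurableSpace α] [MeasurableSpace β]
    (μ : Measure α) (ν : Measure β) [IsFiniteMeasure μ] [IsFiniteMeasure ν]
    (hmass : μ univ = ν univ) : ∃ π : Measure (α × β), π.fst = μ ∧ π.snd = ν := by
  rcases eq_or_ne (μ univ) 0 with hμ | hμ
  · refine ⟨0, ?_, ?_⟩
    · rw [Measure.fst_zero, Measure.measure_univ_eq_zero.1 hμ]
    · rw [Measure.snd_zero, Measure.measure_univ_eq_zero.1 (hmass.symm.trans hμ)]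
  · have hinv : (μ univ)⁻¹ * μ univ = 1 := ENNReal.inv_mul_cancel hμ (measure_ne_top _ _)
    refine ⟨(μ univ)⁻¹ • μ.prod ν, ?_, ?_⟩
    · rw [Measure.fst, Measure.map_smul, Measure.map_fst_prod, smul_smul, ← hmass, hinv, one_smul]
    · rw [Measure.snd, Measure.map_smul, Measure.map_snd_prod, smul_smul, hinv, one_smul]

theorem exists_measure_ge_fst_eq_snd_eq {α β : Type*} [MeasurableSpace α] [MeasurableSpace β]
    (μ : Measure α) (ν : Measure β) [IsFiniteMeasure μ] [IsFiniteMeasure ν]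
    (hmass : μ univ = ν univ) (τ : Measure (α × β)) [IsFiniteMeasure τ] (hfst : τ.fst ≤ μ)
    (hsnd : τ.snd ≤ ν) : ∃ π : Measure (α × β), π.fst = μ ∧ π.snd = ν ∧ τ ≤ π := by
  have hrest : (μ - τ.fst) univ = (ν - τ.snd) univ := by
    rw [Measure.sub_apply MeasurableSet.univ hfst, Measure.sub_apply MeasurableSet.univ hsnd,
      hmass, Measure.fst_univ, Measure.snd_univ]
  obtain ⟨π, hπfst, hπsnd⟩ := exists_measure_fst_eq_snd_eq _ _ hrest
  refine ⟨π + τ, ?_, ?_, Measure.le_add_left le_rfl⟩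
  · rw [Measure.fst_add, hπfst, Measure.sub_add_cancel_of_le hfst]
  · rw [Measure.snd_add, hπsnd, Measure.sub_add_cancel_of_le hsnd]

/-- Pairs of features with law `σ`, put in order at label `0` and in reverse order at label `1`: a
matching of class `0` with class `1` becomes a partial coupling of the data with the data whose
labels are exchanged. -/
def labelCoupling (σ : Measure (ℝ × ℝ)) : Measure (Datum × Datum) :=
  σ.map (fun z => ((z.1, 0), (z.2, 0))) + σ.map fun z => ((z.2, 1), (z.1, 1))

theorem fst_labelCoupling (σ : Measure (ℝ × ℝ)) :
    (labelCoupling σ).fst = labelMeasure ![σ.fst, σ.snd] := by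
  rw [labelCoupling, Measure.fst_add, labelMeasure, Fin.sum_univ_two]
  simp only [Matrix.cons_val_zero, Matrix.cons_val_one, Measure.fst, Measure.snd]
  iterate 4 rw [Measure.map_map (by fun_prop) (by fun_prop)]
  rfl

theorem snd_labelCoupling (σ : Measure (ℝ × ℝ)) :
    (labelCoupling σ).snd = labelMeasure ![σ.snd, σ.fst] := by
  rw [labelCoupling, Measure.snd_add, labelMeasure, Fin.sum_univ_two]
  simp only [Matrix.cons_val_zero, Matrix.cons_val_one, Measure.fst, Measure.snd]
  iterate 4 rw [Measure.map_map (by fun_prop) (by fun_prop)]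
  rfl

theorem labelCoupling_compl_costlySet {σ : Measure (ℝ × ℝ)} {ε : ℝ}
    (hσ : ∀ᵐ z ∂σ, dist z.1 z.2 ≤ 2 * ε) :
    labelCoupling σ (costlySet ε)ᶜ = 2 * σ univ := by
  have hmeas := (measurableSet_costlySet ε).compl
  have h₀ : (fun z : ℝ × ℝ => (((z.1, 0), (z.2, 0)) : Datum × Datum)) ⁻¹' (costlySet ε)ᶜ
      =ᵐ[σ] univ := eventuallyEq_univ.2 <| by
    filter_upwards [hσ] with z hz
    simpa [costlySet] using hz
  have h₁ : (fun z : ℝ × ℝ => (((z.2, 1), (z.1, 1)) : Datum × Datum)) ⁻¹' (costlySet ε)ᶜ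
      =ᵐ[σ] univ := eventuallyEq_univ.2 <| by
    filter_upwards [hσ] with z hz
    simpa [costlySet, dist_comm z.2] using hz
  rw [labelCoupling, Measure.add_apply, Measure.map_apply (by fun_prop) hmeas,
    Measure.map_apply (by fun_prop) hmeas, measure_congr h₀, measure_congr h₁, two_mul]

theorem exists_mem_couplings_two_mul_add_le (μ : Fin 2 → Measure ℝ)
    [IsProbabilityMeasure (labelMeasure μ)] {ε : ℝ} {σ : Measure (ℝ × ℝ)} (hfst : σ.fst ≤ μ 0)
    (hsnd : σ.snd ≤ μ 1) (hσ : ∀ᵐ z ∂σ, dist z.1 z.2 ≤ 2 * ε) :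
    ∃ π ∈ couplings (labelMeasure μ) (swapLabels (labelMeasure μ)),
      2 * σ univ + π (costlySet ε) ≤ 1 := by
  have hswap : IsProbabilityMeasure (swapLabels (labelMeasure μ)) :=
    Measure.isProbabilityMeasure_map measurable_labelSwap.aemeasurable
  have hτfst : (labelCoupling σ).fst ≤ labelMeasure μ := by
    rw [fst_labelCoupling]
    exact labelMeasure_mono (Fin.forall_fin_two.2 ⟨hfst, hsnd⟩)
  have hτsnd : (labelCoupling σ).snd ≤ swapLabels (labelMeasure μ) := by
    rw [snd_labelCoupling, swapLabels_labelMeasure]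
    exact labelMeasure_mono (Fin.forall_fin_two.2 ⟨hsnd, hfst⟩)
  have : IsFiniteMeasure (labelCoupling σ) := ⟨by
    rw [← Measure.fst_univ]
    exact (hτfst univ).trans_lt (measure_lt_top _ _)⟩
  obtain ⟨π, hπfst, hπsnd, hle⟩ := exists_measure_ge_fst_eq_snd_eq (labelMeasure μ)
    (swapLabels (labelMeasure μ)) (by simp) (labelCoupling σ) hτfst hτsnd
  have hprob : IsProbabilityMeasure π := ⟨by rw [← Measure.fst_univ, hπfst, measure_univ]⟩
  refine ⟨π, ⟨hprob, hπfst, hπsnd⟩, ?_⟩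
  calc 2 * σ univ + π (costlySet ε) = labelCoupling σ (costlySet ε)ᶜ + π (costlySet ε) := by
        rw [labelCoupling_compl_costlySet hσ]
    _ ≤ π (costlySet ε)ᶜ + π (costlySet ε) := by gcongr
    _ = 1 := by rw [add_comm, measure_add_measure_compl (measurableSet_costlySet ε), measure_univ]

/-! ### Measures with a continuous density -/

open intervalIntegral

/-- The measure on the real line with density `f`, the negative part of `f` being discarded. -/
def densityMeasure (f : ℝ → ℝ) : Measure ℝ := volume.withDensity (fun x => ENNReal.ofReal (f x))

section Density

variable {f g : ℝ → ℝ}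

theorem densityMeasure_apply {s : Set ℝ} (hs : MeasurableSet s) :
    densityMeasure f s = ∫⁻ x in s, ENNReal.ofReal (f x) := withDensity_apply _ hs

theorem densityMeasure_Icc (hf : Continuous f) (hf₀ : ∀ x, 0 ≤ f x) {q p : ℝ} (hqp : q ≤ p) :
    densityMeasure f (Icc q p) = ENNReal.ofReal (∫ x in q..p, f x) := by
  rw [densityMeasure_apply measurableSet_Icc, integral_of_le hqp, ← integral_Icc_eq_integral_Ioc,
    ofReal_integral_eq_lintegral_ofReal hf.continuousOn.integrableOn_Icc (ae_of_all _ hf₀)]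

theorem densityMeasure_restrict_Icc_Iic (hf : Continuous f) (hf₀ : ∀ x, 0 ≤ f x) {q p : ℝ}
    (hqp : q ≤ p) (x : ℝ) :
    (densityMeasure f).restrict (Icc q p) (Iic x) =
      ENNReal.ofReal (∫ t in q..max q (min x p), f t) := by
  have hinter : Iic x ∩ Icc q p = Icc q (min x p) := by
    ext y; simp only [mem_inter_iff, mem_Iic, mem_Icc, le_min_iff]; tauto
  rw [Measure.restrict_apply measurableSet_Iic, hinter]
  rcases lt_or_ge x q with hx | hx
  · rw [Icc_eq_empty (by simp [hx]), max_eq_left (min_le_of_left_le hx.le), integral_same,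
      measure_empty, ENNReal.ofReal_zero]
  · rw [max_eq_right (le_min hx hqp), densityMeasure_Icc hf hf₀ (le_min hx hqp)]

theorem isFiniteMeasure_densityMeasure_restrict_Icc (hf : Continuous f) (hf₀ : ∀ x, 0 ≤ f x)
    {q p : ℝ} (hqp : q ≤ p) : IsFiniteMeasure ((densityMeasure f).restrict (Icc q p)) :=
  ⟨by rw [Measure.restrict_apply_univ, densityMeasure_Icc hf hf₀ hqp]; exact ENNReal.ofReal_lt_top⟩

theorem exists_isShortCoupling_densityMeasure (hf : Continuous f) (hg : Continuous g)
    (hf₀ : ∀ x, 0 ≤ f x) (hg₀ : ∀ x, 0 ≤ g x) {q p η : ℝ} (hqp : q ≤ p) (hη : 0 ≤ η)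
    (hmass : ∫ x in q..p, f x = ∫ x in q..p, g x)
    (hle : ∀ x ∈ Icc q p, ∫ t in q..x, g t ≤ ∫ t in q..x, f t)
    (hle_add : ∀ x, q ≤ x → x + η ≤ p → ∫ t in q..x, f t ≤ ∫ t in q..(x + η), g t) :
    ∃ σ, IsShortCoupling ((densityMeasure f).restrict (Icc q p))
      ((densityMeasure g).restrict (Icc q p)) η σ := by
  have := isFiniteMeasure_densityMeasure_restrict_Icc hf hf₀ hqp
  have := isFiniteMeasure_densityMeasure_restrict_Icc hg hg₀ hqp
  refine exists_isShortCoupling_of_measure_Iic_le _ _ ?_ (fun x => ?_) fun x => ?_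
  · simp only [Measure.restrict_apply_univ, densityMeasure_Icc hf hf₀ hqp,
      densityMeasure_Icc hg hg₀ hqp, hmass]
  all_goals
    rw [densityMeasure_restrict_Icc_Iic hf hf₀ hqp, densityMeasure_restrict_Icc_Iic hg hg₀ hqp]
    refine ENNReal.ofReal_le_ofReal ?_
  · exact hle _ ⟨le_max_left _ _, max_le hqp (min_le_right _ _)⟩
  · rcases lt_or_ge x q with hx | hx
    · rw [max_eq_left (min_le_of_left_le hx.le), integral_same]
      exact integral_nonneg (le_max_left _ _) fun y _ => hg₀ y
    rw [max_eq_right (le_min hx hqp), max_eq_right (le_min (by linarith) hqp)]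
    rcases le_total (x + η) p with hp | hp
    · rw [min_eq_left hp, min_eq_left (by linarith)]
      exact hle_add x hx hp
    · rw [min_eq_right hp, ← hmass]
      exact integral_mono_interval le_rfl (le_min hx hqp) (min_le_right _ _)
        (ae_of_all _ hf₀) (hf.intervalIntegrable _ _)

end Density

/-! ### Transversal crossings of two densities -/

/-- The functions `f` and `g` cross transversally at `c`, `g` overtaking `f`: on the closed ball of
radius `δ` around `c` every slope of `f` is smaller than every slope of `g`. -/
structure IsUpcrossing (f g : ℝ → ℝ) (c δ : ℝ) : Prop where
  contDiff_left : ContDiff ℝ 1 f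
  contDiff_right : ContDiff ℝ 1 g
  pos : 0 < δ
  eq : f c = g c
  slope_lt : ∀ u ∈ Icc (c - δ) (c + δ), ∀ v ∈ Icc (c - δ) (c + δ), deriv f v < deriv g u

/-- The interval `[q, p]` contains `c`, `t - ε` and `t + ε`, lies in the ball of radius `δ` around
`c`, and on either side the mass of `f` beyond `t - ε` equals the mass of `g` beyond `t + ε`: the
monotone coupling of `f` and `g` on `[q, p]` sends `t - ε` to `t + ε`. -/
structure IsBalancedWindow (f g : ℝ → ℝ) (c δ ε t q p : ℝ) : Prop where
  left_le_sub : q ≤ t - ε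
  left_le : q ≤ c
  le_left : c - δ ≤ q
  integral_left : ∫ x in q..(t - ε), f x = ∫ x in q..(t + ε), g x
  add_le_right : t + ε ≤ p
  le_right : c ≤ p
  right_le : p ≤ c + δ
  integral_right : ∫ x in (t - ε)..p, f x = ∫ x in (t + ε)..p, g x

theorem exists_isUpcrossing {f g : ℝ → ℝ} (hf : ContDiff ℝ 1 f) (hg : ContDiff ℝ 1 g) {c : ℝ}
    (hc : f c = g c) (hlt : deriv f c < deriv g c) {δ : ℝ} (hδ : 0 < δ) :
    ∃ δ' ≤ δ, IsUpcrossing f g c δ' := by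
  have := hf.continuous_deriv le_rfl
  have := hg.continuous_deriv le_rfl
  have hev : ∀ᶠ u : ℝ × ℝ in 𝓝 (c, c), deriv f u.2 < deriv g u.1 :=
    ContinuousAt.eventually_lt (by fun_prop) (by fun_prop) hlt
  obtain ⟨R, hR, hball⟩ := Metric.nhds_basis_closedBall.eventually_iff.1 hev
  refine ⟨min δ R, min_le_left _ _, hf, hg, lt_min hδ hR, hc, fun u hu v hv =>
    hball (x := (u, v)) ?_⟩
  rw [← closedBall_prod_same]
  simp only [← Real.closedBall_eq_Icc] at hu hv
  exact ⟨Metric.closedBall_subset_closedBall (min_le_right _ _) hu,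
    Metric.closedBall_subset_closedBall (min_le_right _ _) hv⟩

namespace IsUpcrossing

variable {f g : ℝ → ℝ} {c δ : ℝ}

theorem hasDerivAt_left (h : IsUpcrossing f g c δ) (x : ℝ) : HasDerivAt f (deriv f x) x :=
  (h.contDiff_left.differentiable one_ne_zero x).hasDerivAt

theorem hasDerivAt_right (h : IsUpcrossing f g c δ) (x : ℝ) : HasDerivAt g (deriv g x) x :=
  (h.contDiff_right.differentiable one_ne_zero x).hasDerivAt

theorem reflect (h : IsUpcrossing f g c δ) :
    IsUpcrossing (fun x => g (-x)) (fun x => f (-x)) (-c) δ where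
  contDiff_left := h.contDiff_right.comp contDiff_neg
  contDiff_right := h.contDiff_left.comp contDiff_neg
  pos := h.pos
  eq := by simpa only [neg_neg] using h.eq.symm
  slope_lt := fun u hu v hv => by
    rw [deriv_comp_neg, deriv_comp_neg, neg_lt_neg_iff]
    exact h.slope_lt (-v) ⟨by linarith [hv.2], by linarith [hv.1]⟩ (-u)
      ⟨by linarith [hu.2], by linarith [hu.1]⟩

theorem sub_lt_sub (h : IsUpcrossing f g c δ) {s t x y : ℝ} (hxy : x < y)
    (hs : c - δ ≤ x + s) (hs' : y + s ≤ c + δ) (ht : c - δ ≤ x + t) (ht' : y + t ≤ c + δ) :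
    g (x + s) - f (x + t) < g (y + s) - f (y + t) := by
  have hderiv : ∀ z, HasDerivAt (fun z => g (z + s) - f (z + t))
      (deriv g (z + s) - deriv f (z + t)) z := fun z =>
    ((h.hasDerivAt_right (z + s)).comp_add_const z s).sub
      ((h.hasDerivAt_left (z + t)).comp_add_const z t)
  have hmono : StrictMonoOn (fun z => g (z + s) - f (z + t)) (Icc x y) := by
    refine strictMonoOn_of_deriv_pos (convex_Icc x y)
      (fun z _ => (hderiv z).continuousAt.continuousWithinAt) fun z hz => ?_
    rw [interior_Icc] at hz
    rw [(hderiv z).deriv, sub_pos]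
    exact h.slope_lt _ ⟨by linarith [hz.1], by linarith [hz.2]⟩ _
      ⟨by linarith [hz.1], by linarith [hz.2]⟩
  exact hmono (left_mem_Icc.2 hxy.le) (right_mem_Icc.2 hxy.le) hxy

theorem sub_le_sub (h : IsUpcrossing f g c δ) {s t x y : ℝ} (hxy : x ≤ y)
    (hs : c - δ ≤ x + s) (hs' : y + s ≤ c + δ) (ht : c - δ ≤ x + t) (ht' : y + t ≤ c + δ) :
    g (x + s) - f (x + t) ≤ g (y + s) - f (y + t) := by
  rcases hxy.eq_or_lt with rfl | hlt
  · exact le_rfl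
  · exact (h.sub_lt_sub hlt hs hs' ht ht').le

theorem lt_of_gt (h : IsUpcrossing f g c δ) {x : ℝ} (hx : c < x) (hx' : x ≤ c + δ) :
    f x < g x := by
  have := h.sub_lt_sub (s := 0) (t := 0) hx (by linarith [h.pos]) (by linarith)
    (by linarith [h.pos]) (by linarith)
  simp only [add_zero, h.eq] at this
  linarith

theorem lt_of_lt (h : IsUpcrossing f g c δ) {x : ℝ} (hx : x < c) (hx' : c - δ ≤ x) :
    g x < f x := by
  simpa only [neg_neg] using h.reflect.lt_of_gt (neg_lt_neg hx) (by linarith)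

theorem le_of_ge (h : IsUpcrossing f g c δ) {x : ℝ} (hx : c ≤ x) (hx' : x ≤ c + δ) :
    f x ≤ g x := by
  rcases hx.eq_or_lt with rfl | hlt
  · exact h.eq.le
  · exact (h.lt_of_gt hlt hx').le

theorem le_of_le (h : IsUpcrossing f g c δ) {x : ℝ} (hx : x ≤ c) (hx' : c - δ ≤ x) :
    g x ≤ f x := by
  simpa only [neg_neg] using h.reflect.le_of_ge (neg_le_neg hx) (by linarith)

theorem exists_right_end (h : IsUpcrossing f g c δ) (hf₀ : ∀ x, 0 ≤ f x) {ε t : ℝ} (hε : 0 ≤ ε)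
    (ht : t + ε ≤ c + δ) (ht' : c - δ ≤ t + ε)
    (hle : ∫ x in (t - ε)..(c + δ), f x ≤ ∫ x in (t + ε)..(c + δ), g x) :
    ∃ p, t + ε ≤ p ∧ c ≤ p ∧ p ≤ c + δ ∧ ∫ x in (t - ε)..p, f x = ∫ x in (t + ε)..p, g x := by
  have hf := h.contDiff_left.continuous
  have hg := h.contDiff_right.continuous
  have hcont : Continuous fun p => (∫ x in (t + ε)..p, g x) - ∫ x in (t - ε)..p, f x :=
    (continuous_primitive (fun a b => hg.intervalIntegrable a b) _).sub
      (continuous_primitive (fun a b => hf.intervalIntegrable a b) _)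
  have hlow : (∫ x in (t + ε)..(max (t + ε) c), g x) - ∫ x in (t - ε)..(max (t + ε) c), f x
      ≤ 0 := by
    rw [← integral_add_adjacent_intervals (hf.intervalIntegrable (t - ε) (t + ε))
      (hf.intervalIntegrable _ _)]
    have hmid : 0 ≤ ∫ x in (t - ε)..(t + ε), f x :=
      integral_nonneg (by linarith) fun x _ => hf₀ x
    have hle' : ∫ x in (t + ε)..(max (t + ε) c), g x ≤ ∫ x in (t + ε)..(max (t + ε) c), f x := by
      rcases le_total c (t + ε) with hc | hc
      · rw [max_eq_left hc, integral_same, integral_same]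
      · rw [max_eq_right hc]
        exact integral_mono_on hc (hg.intervalIntegrable _ _) (hf.intervalIntegrable _ _)
          fun x hx => h.le_of_le hx.2 (ht'.trans hx.1)
    linarith
  obtain ⟨p, hp, hp₀⟩ := intermediate_value_Icc (max_le ht (by linarith [h.pos]))
    hcont.continuousOn (show (0 : ℝ) ∈ Icc _ _ from ⟨hlow, sub_nonneg.2 hle⟩)
  exact ⟨p, (le_max_left _ _).trans hp.1, (le_max_right _ _).trans hp.1, hp.2,
    (sub_eq_zero.1 hp₀).symm⟩

theorem eventually_integral_right_lt (h : IsUpcrossing f g c δ) : ∀ᶠ u : ℝ × ℝ in 𝓝 (0, c),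
    ∫ x in (u.2 - u.1)..(c + δ), f x < ∫ x in (u.2 + u.1)..(c + δ), g x := by
  have hf := h.contDiff_left.continuous
  have hg := h.contDiff_right.continuous
  have hcont : ∀ {k : ℝ → ℝ}, Continuous k → Continuous fun a => ∫ x in a..(c + δ), k x :=
    fun hk => by
      simp only [integral_symm (c + δ)]
      exact (continuous_primitive (fun a b => hk.intervalIntegrable a b) _).neg
  refine ContinuousAt.eventually_lt
    ((hcont hf).comp (continuous_snd.sub continuous_fst)).continuousAt
    ((hcont hg).comp (continuous_snd.add continuous_fst)).continuousAt ?_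
  have hδ := h.pos
  simp only [add_zero, sub_zero]
  exact integral_lt_integral_of_continuousOn_of_le_of_exists_lt (by linarith) hf.continuousOn
    hg.continuousOn (fun x hx => h.le_of_ge hx.1.le hx.2)
    ⟨c + δ, right_mem_Icc.2 (by linarith), h.lt_of_gt (by linarith) le_rfl⟩

theorem eventually_exists_right_end (h : IsUpcrossing f g c δ) (hf₀ : ∀ x, 0 ≤ f x) :
    ∀ᶠ u : ℝ × ℝ in 𝓝 (0, c), 0 ≤ u.1 → ∃ p, u.2 + u.1 ≤ p ∧ c ≤ p ∧ p ≤ c + δ ∧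
      ∫ x in (u.2 - u.1)..p, f x = ∫ x in (u.2 + u.1)..p, g x := by
  have hnear : ∀ᶠ u : ℝ × ℝ in 𝓝 (0, c), u.2 + u.1 ∈ Icc (c - δ) (c + δ) := by
    have hcont : ContinuousAt (fun u : ℝ × ℝ => u.2 + u.1) (0, c) := by fun_prop
    refine hcont (Icc_mem_nhds ?_ ?_) <;> simp [h.pos]
  filter_upwards [hnear, h.eventually_integral_right_lt] with u hu hlt hε
  exact h.exists_right_end hf₀ hε hu.2 hu.1 hlt.le

theorem eventually_exists_left_end (h : IsUpcrossing f g c δ) (hg₀ : ∀ x, 0 ≤ g x) :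
    ∀ᶠ u : ℝ × ℝ in 𝓝 (0, c), 0 ≤ u.1 → ∃ q, q ≤ u.2 - u.1 ∧ q ≤ c ∧ c - δ ≤ q ∧
      ∫ x in q..(u.2 - u.1), f x = ∫ x in q..(u.2 + u.1), g x := by
  have hneg : Tendsto (fun u : ℝ × ℝ => (u.1, -u.2)) (𝓝 (0, c)) (𝓝 (0, -c)) :=
    (continuous_fst.prodMk continuous_snd.neg).tendsto (0, c)
  filter_upwards [hneg.eventually (h.reflect.eventually_exists_right_end fun x => hg₀ (-x))]
    with u hu hε
  obtain ⟨p, hp, hcp, hpδ, hint⟩ := hu hε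
  refine ⟨-p, by linarith, by linarith, by linarith, ?_⟩
  rw [integral_comp_neg, integral_comp_neg] at hint
  convert! hint.symm using 2 <;> ring

theorem eventually_exists_isBalancedWindow (h : IsUpcrossing f g c δ) (hf₀ : ∀ x, 0 ≤ f x)
    (hg₀ : ∀ x, 0 ≤ g x) : ∀ᶠ u : ℝ × ℝ in 𝓝 (0, c), 0 ≤ u.1 →
      ∃ q p, IsBalancedWindow f g c δ u.1 u.2 q p := by
  filter_upwards [h.eventually_exists_left_end hg₀, h.eventually_exists_right_end hf₀]
    with u hleft hright hε
  obtain ⟨q, hq₁, hq₂, hq₃, hq⟩ := hleft hε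
  obtain ⟨p, hp₁, hp₂, hp₃, hp⟩ := hright hε
  exact ⟨q, p, hq₁, hq₂, hq₃, hq, hp₁, hp₂, hp₃, hp⟩

end IsUpcrossing

namespace IsBalancedWindow

variable {f g : ℝ → ℝ} {c δ ε t q p : ℝ}

theorem integral_eq (hw : IsBalancedWindow f g c δ ε t q p) (hf : Continuous f)
    (hg : Continuous g) : ∫ x in q..p, f x = ∫ x in q..p, g x := by
  rw [← integral_add_adjacent_intervals (hf.intervalIntegrable q (t - ε))
      (hf.intervalIntegrable (t - ε) p), hw.integral_left, hw.integral_right,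
    integral_add_adjacent_intervals (hg.intervalIntegrable _ _) (hg.intervalIntegrable _ _)]

theorem integral_le_integral (hw : IsBalancedWindow f g c δ ε t q p) (h : IsUpcrossing f g c δ)
    {x : ℝ} (hx : x ∈ Icc q p) : ∫ y in q..x, g y ≤ ∫ y in q..x, f y := by
  have hf := h.contDiff_left.continuous
  have hg := h.contDiff_right.continuous
  rcases le_total x c with hxc | hxc
  · exact integral_mono_on hx.1 (hg.intervalIntegrable _ _) (hf.intervalIntegrable _ _)
      fun y hy => h.le_of_le (hy.2.trans hxc) (hw.le_left.trans hy.1)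
  · have hright : ∫ y in x..p, f y ≤ ∫ y in x..p, g y :=
      integral_mono_on hx.2 (hf.intervalIntegrable _ _) (hg.intervalIntegrable _ _)
        fun y hy => h.le_of_ge (hxc.trans hy.1) (hy.2.trans hw.right_le)
    have hsum := hw.integral_eq hf hg
    rw [← integral_add_adjacent_intervals (hf.intervalIntegrable q x) (hf.intervalIntegrable x p),
      ← integral_add_adjacent_intervals (hg.intervalIntegrable q x) (hg.intervalIntegrable x p)]
      at hsum
    linarith

theorem integral_le_integral_add (hw : IsBalancedWindow f g c δ ε t q p)
    (h : IsUpcrossing f g c δ) (hε : 0 ≤ ε) (ht : g (t + ε) = f (t - ε)) {x : ℝ} (hqx : q ≤ x)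
    (hxp : x + 2 * ε ≤ p) : ∫ y in q..x, f y ≤ ∫ y in q..(x + 2 * ε), g y := by
  obtain ⟨hqt, -, hδq, hq, htp, -, hpδ, -⟩ := hw
  have hf := h.contDiff_left.continuous
  have hg := h.contDiff_right.continuous
  have hgε : Continuous fun y => g (y + 2 * ε) := by fun_prop
  have hshift : t - ε + 2 * ε = t + ε := by ring
  -- The balance at `t` makes `y ↦ g (y + 2 ε) - f y` change its sign at `t - ε`.
  rcases le_total x (t - ε) with hx | hx
  · have hle : ∫ y in x..(t - ε), g (y + 2 * ε) ≤ ∫ y in x..(t - ε), f y := by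
      refine integral_mono_on hx (hgε.intervalIntegrable _ _) (hf.intervalIntegrable _ _)
        fun y hy => ?_
      have := h.sub_le_sub (s := 2 * ε) (t := 0) hy.2 (by linarith [hy.1]) (by linarith)
        (by linarith [hy.1]) (by linarith)
      rw [hshift, ht, add_zero, add_zero] at this
      linarith
    rw [integral_comp_add_right, hshift] at hle
    rw [← integral_add_adjacent_intervals (hf.intervalIntegrable q x) (hf.intervalIntegrable x _),
      ← integral_add_adjacent_intervals (hg.intervalIntegrable q (x + 2 * ε))
        (hg.intervalIntegrable _ _)] at hq
    linarith
  · have hle : ∫ y in (t - ε)..x, f y ≤ ∫ y in (t - ε)..x, g (y + 2 * ε) := by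
      refine integral_mono_on hx (hf.intervalIntegrable _ _) (hgε.intervalIntegrable _ _)
        fun y hy => ?_
      have := h.sub_le_sub (s := 2 * ε) (t := 0) hy.1 (by linarith) (by linarith [hy.2])
        (by linarith) (by linarith [hy.2])
      rw [hshift, ht, add_zero, add_zero] at this
      linarith
    rw [integral_comp_add_right, hshift] at hle
    rw [← integral_add_adjacent_intervals (hf.intervalIntegrable q (t - ε))
        (hf.intervalIntegrable _ x),
      ← integral_add_adjacent_intervals (hg.intervalIntegrable q (t + ε))
        (hg.intervalIntegrable _ (x + 2 * ε))]
    linarith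

theorem exists_isShortCoupling (hw : IsBalancedWindow f g c δ ε t q p) (h : IsUpcrossing f g c δ)
    (hf₀ : ∀ x, 0 ≤ f x) (hg₀ : ∀ x, 0 ≤ g x) (hε : 0 ≤ ε) (ht : g (t + ε) = f (t - ε)) :
    ∃ σ, IsShortCoupling ((densityMeasure f).restrict (Icc q p))
      ((densityMeasure g).restrict (Icc q p)) (2 * ε) σ :=
  exists_isShortCoupling_densityMeasure h.contDiff_left.continuous h.contDiff_right.continuous
    hf₀ hg₀ (hw.left_le.trans hw.le_right) (by linarith)
    (hw.integral_eq h.contDiff_left.continuous h.contDiff_right.continuous)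
    (fun _ hx => hw.integral_le_integral h hx)
    fun _ hqx hxp => hw.integral_le_integral_add h hε ht hqx hxp

end IsBalancedWindow

/-! ### The evolution of an endpoint -/

/-- `y` solves on `[0, T]` the evolution equation of an endpoint at which `g` overtakes `f`, with a
denominator that does not vanish. -/
def IsCrossingCurve (f g : ℝ → ℝ) (T : ℝ) (y : ℝ → ℝ) : Prop :=
  ∀ ε ∈ Icc 0 T, deriv g (y ε + ε) - deriv f (y ε - ε) ≠ 0 ∧
    HasDerivWithinAt y
      (-((deriv g (y ε + ε) + deriv f (y ε - ε)) / (deriv g (y ε + ε) - deriv f (y ε - ε))))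
      (Icc 0 T) ε

theorem eventually_forall_mem_Icc {a : ℝ} {P : ℝ → Prop} (h : ∀ᶠ x in 𝓝[≥] a, P x) :
    ∀ᶠ T in 𝓝[>] a, ∀ x ∈ Icc a T, P x := by
  obtain ⟨u, hu, hsub⟩ := mem_nhdsGE_iff_exists_Icc_subset.1 h
  filter_upwards [Ioc_mem_nhdsGT hu] with T hT x hx using hsub ⟨hx.1, hx.2.trans hT.2⟩

section Balance

variable {f g : ℝ → ℝ}

theorem hasDerivWithinAt_balance (hf : Differentiable ℝ f) (hg : Differentiable ℝ g) {y : ℝ → ℝ}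
    {y' s : ℝ} {S : Set ℝ} (hy : HasDerivWithinAt y y' S s) :
    HasDerivWithinAt (fun s => g (y s + s) - f (y s - s))
      (y' * (deriv g (y s + s) - deriv f (y s - s)) + (deriv g (y s + s) + deriv f (y s - s)))
      S s := by
  have hplus : HasDerivWithinAt (fun s => g (y s + s)) (deriv g (y s + s) * (y' + 1)) S s :=
    (hg (y s + s)).hasDerivAt.comp_hasDerivWithinAt (h := fun s => y s + s) s
      (hy.add (hasDerivWithinAt_id s S))
  have hminus : HasDerivWithinAt (fun s => f (y s - s)) (deriv f (y s - s) * (y' - 1)) S s :=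
    (hf (y s - s)).hasDerivAt.comp_hasDerivWithinAt (h := fun s => y s - s) s
      (hy.sub (hasDerivWithinAt_id s S))
  convert! hplus.sub hminus using 1
  ring

theorem IsCrossingCurve.balance_eq {T : ℝ} {y : ℝ → ℝ} (hy : IsCrossingCurve f g T y)
    (hf : Differentiable ℝ f) (hg : Differentiable ℝ g) {ε : ℝ} (hε : ε ∈ Icc 0 T) :
    g (y ε + ε) - f (y ε - ε) = g (y 0) - f (y 0) := by
  have hderiv : ∀ s ∈ Icc 0 T,
      HasDerivWithinAt (fun s => g (y s + s) - f (y s - s)) 0 (Icc 0 T) s := by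
    intro s hs
    have := hasDerivWithinAt_balance hf hg (hy s hs).2
    rwa [neg_mul, div_mul_cancel₀ _ (hy s hs).1, neg_add_cancel] at this
  simpa only [add_zero, sub_zero] using
    constant_of_has_deriv_right_zero (fun s hs => (hderiv s hs).continuousWithinAt)
      (fun s hs =>
        (hderiv s ⟨hs.1, hs.2.le⟩).mono_of_mem_nhdsWithin (Icc_mem_nhdsGE_of_mem hs)) ε hε

theorem hasDerivAt_of_eventually_balance_eq (hf : Differentiable ℝ f) (hg : Differentiable ℝ g)
    {y : ℝ → ℝ} {s a : ℝ} (hy : DifferentiableAt ℝ y s)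
    (hD : deriv g (y s + s) - deriv f (y s - s) ≠ 0)
    (hconst : ∀ᶠ r in 𝓝 s, g (y r + r) - f (y r - r) = a) :
    HasDerivAt y
      (-((deriv g (y s + s) + deriv f (y s - s)) / (deriv g (y s + s) - deriv f (y s - s)))) s := by
  have hbalance : HasDerivAt (fun r => g (y r + r) - f (y r - r)) _ s :=
    (hasDerivWithinAt_balance hf hg (hy.hasDerivAt.hasDerivWithinAt (s := univ))).hasDerivAt
      univ_mem
  have hzero : HasDerivAt (fun r => g (y r + r) - f (y r - r)) 0 s :=
    (hasDerivAt_const s a).congr_of_eventuallyEq hconst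
  have hderiv : deriv y s =
      -((deriv g (y s + s) + deriv f (y s - s)) / (deriv g (y s + s) - deriv f (y s - s))) := by
    rw [← neg_div, eq_div_iff hD]
    linarith [hbalance.unique hzero]
  exact hderiv ▸ hy.hasDerivAt

theorem exists_contDiffAt_balance_eq (hf : ContDiff ℝ 1 f) (hg : ContDiff ℝ 1 g) {c : ℝ}
    (hc : deriv f c ≠ deriv g c) :
    ∃ y : ℝ → ℝ, y 0 = c ∧ ContDiffAt ℝ 1 y 0 ∧
      ∀ᶠ s in 𝓝 0, g (y s + s) - f (y s - s) = g c - f c := by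
  let F : ℝ × ℝ → ℝ := fun u => g (u.2 + u.1) - f (u.2 - u.1)
  have hF : ContDiffAt ℝ 1 F (0, c) := ContDiff.contDiffAt (by fun_prop)
  have hinv : (fderiv ℝ F (0, c) ∘L .inr ℝ ℝ ℝ).IsInvertible := by
    have hfderiv : HasDerivAt (fun t : ℝ => F (0, t)) (fderiv ℝ F (0, c) (0, 1)) c :=
      (hF.differentiableAt one_ne_zero).hasFDerivAt.comp_hasDerivAt (x := c)
        (f := fun t : ℝ => ((0 : ℝ), t)) ((hasDerivAt_const c (0 : ℝ)).prodMk (hasDerivAt_id c))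
    have hderiv : HasDerivAt (fun t : ℝ => F (0, t)) (deriv g c - deriv f c) c := by
      simp only [F, add_zero, sub_zero]
      exact (hg.differentiable one_ne_zero c).hasDerivAt.sub
        (hf.differentiable one_ne_zero c).hasDerivAt
    refine ⟨ContinuousLinearEquiv.unitsEquivAut ℝ
      (Units.mk0 (deriv g c - deriv f c) (sub_ne_zero.2 hc.symm)), ?_⟩
    ext
    simp [hfderiv.unique hderiv]
  refine ⟨hF.implicitFunction one_ne_zero hinv, hF.implicitFunction_apply_self one_ne_zero hinv,
    hF.contDiffAt_implicitFunction one_ne_zero hinv, ?_⟩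
  simpa only [F, add_zero, sub_zero] using hF.eventually_apply_implicitFunction one_ne_zero hinv

theorem exists_eventually_isCrossingCurve (hf : ContDiff ℝ 1 f) (hg : ContDiff ℝ 1 g) {c : ℝ}
    (hc : deriv f c ≠ deriv g c) :
    ∃ y : ℝ → ℝ, y 0 = c ∧ ∀ᶠ T in 𝓝[>] 0, IsCrossingCurve f g T y := by
  obtain ⟨y, hy₀, hy, hbalance⟩ := exists_contDiffAt_balance_eq hf hg hc
  have hD : ∀ᶠ s in 𝓝 0, deriv g (y s + s) - deriv f (y s - s) ≠ 0 := by
    have := hf.continuous_deriv le_rfl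
    have := hg.continuous_deriv le_rfl
    have hcont := hy.continuousAt
    have : ContinuousAt (fun s => deriv g (y s + s) - deriv f (y s - s)) 0 := by fun_prop
    refine this.eventually_ne ?_
    simpa only [hy₀, add_zero, sub_zero] using sub_ne_zero.2 hc.symm
  have hsol := hD.and (hbalance.eventually_nhds.and (hy.eventually (by simp)))
  refine ⟨y, hy₀, (eventually_forall_mem_Icc (hsol.filter_mono nhdsWithin_le_nhds)).mono
    fun T hT s hs => ?_⟩
  obtain ⟨hDs, hbs, hys⟩ := hT s hs
  exact ⟨hDs, (hasDerivAt_of_eventually_balance_eq (hf.differentiable one_ne_zero)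
    (hg.differentiable one_ne_zero) (hys.differentiableAt one_ne_zero) hDs hbs).hasDerivWithinAt⟩

end Balance

namespace IsUpcrossing

variable {f g : ℝ → ℝ} {c δ : ℝ}

theorem eventually_lt_and_lt (h : IsUpcrossing f g c δ) {r : ℝ} (hr : 0 < r) (hrδ : r ≤ δ) :
    ∀ᶠ ε in 𝓝 0, g (c - r + ε) < f (c - r - ε) ∧ f (c + r - ε) < g (c + r + ε) := by
  have hf := h.contDiff_left.continuous
  have hg := h.contDiff_right.continuous
  refine Eventually.and ?_ ?_ <;>
    refine ContinuousAt.eventually_lt (by fun_prop) (by fun_prop) ?_ <;>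
    simp only [add_zero, sub_zero]
  · exact h.lt_of_lt (by linarith) (by linarith)
  · exact h.lt_of_gt (by linarith) (by linarith)

theorem eventually_forall_isCrossingCurve_mem (h : IsUpcrossing f g c δ) {s : Set ℝ}
    (hs : s ∈ 𝓝 c) : ∀ᶠ T in 𝓝[>] 0, ∀ y : ℝ → ℝ, y 0 = c → IsCrossingCurve f g T y →
      ∀ ε ∈ Icc 0 T, y ε ∈ s := by
  obtain ⟨R, hR, hball⟩ := Metric.nhds_basis_closedBall.mem_iff.1 hs
  obtain ⟨r, hr, hrR, hrδ⟩ : ∃ r, 0 < r ∧ r ≤ R ∧ r ≤ δ :=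
    ⟨min R δ, lt_min hR h.pos, min_le_left _ _, min_le_right _ _⟩
  -- The conserved balance is violated at `c - r` and at `c + r`, so a solution crosses neither.
  have hbarrier := (h.eventually_lt_and_lt hr hrδ).filter_mono (nhdsWithin_le_nhds (s := Ici 0))
  filter_upwards [eventually_forall_mem_Icc hbarrier] with T hT y hy₀ hy ε hε
  refine hball (Metric.closedBall_subset_closedBall hrR ?_)
  by_contra hout
  have hcont : ContinuousOn y (Icc 0 ε) := fun u hu =>
    (hy u ⟨hu.1, hu.2.trans hε.2⟩).2.continuousWithinAt.mono (Icc_subset_Icc_right hε.2)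
  obtain ⟨u, hu, hyu⟩ : ∃ u ∈ Icc 0 ε, dist (y u) c = r :=
    intermediate_value_Icc hε.1 (by fun_prop : ContinuousOn (fun u => dist (y u) c) _)
      ⟨by simp [hy₀, hr.le], (not_le.1 hout).le⟩
  have hu' : u ∈ Icc 0 T := ⟨hu.1, hu.2.trans hε.2⟩
  have hbalance := hy.balance_eq (h.contDiff_left.differentiable one_ne_zero)
    (h.contDiff_right.differentiable one_ne_zero) hu'
  rw [hy₀, h.eq, sub_self, sub_eq_zero] at hbalance
  rw [Real.dist_eq, abs_eq hr.le, sub_eq_iff_eq_add', sub_eq_iff_eq_add', ← sub_eq_add_neg] at hyu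
  rcases hyu with hyu | hyu <;> rw [hyu] at hbalance
  · exact (hT u hu').2.ne' hbalance
  · exact (hT u hu').1.ne hbalance

end IsUpcrossing

/-! ### Windows around the moving endpoints -/

/-- The evolution equation of an endpoint at which `g` overtakes `f`: for the left endpoints of the
classifier `f` and `g` are the densities of the classes `0` and `1`, for the right endpoints the
roles are exchanged. -/
def CrossingEvolves (f g : ℝ → ℝ) (T : ℝ) (c₀ : EReal) (c : ℝ → EReal) : Prop :=
  EndpointEvolves (fun ε t => deriv g (t + ε) + deriv f (t - ε))
    (fun ε t => deriv g (t + ε) - deriv f (t - ε)) T c₀ c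

/-- An endpoint has moved from `c₀` to `c` within the set `J`, on which `f` and `g` can be matched
with displacement at most `2 ε`. By `lt_of_le` and `lt_of_ge` a point outside `J` lies on the same
side of `c₀` as all the points within distance `ε` of it lie of `c`; `measure_le` is half of the
statement that the matching sends the mass of `f` to the left of `c - ε` onto the mass of `g` to the
left of `c + ε`. An infinite endpoint has the empty window. -/
structure IsWindow (f g : ℝ → ℝ) (δ ε : ℝ) (c₀ c : EReal) (J : Set ℝ) : Prop where
  measurableSet : MeasurableSet J
  near : ∀ x ∈ J, ∃ r : ℝ, c₀ = r ∧ |x - r| ≤ δ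
  lt_of_le : ∀ x ∉ J, c ≤ ((x + ε : ℝ) : EReal) → c₀ < (x : EReal)
  lt_of_ge : ∀ x ∉ J, c₀ ≤ (x : EReal) → c < ((x - ε : ℝ) : EReal)
  exists_isShortCoupling :
    ∃ σ, IsShortCoupling ((densityMeasure f).restrict J) ((densityMeasure g).restrict J) (2 * ε) σ
  measure_le : densityMeasure f (J ∩ {x | c ≤ ((x + ε : ℝ) : EReal)}) +
    densityMeasure g (J ∩ {x | ((x - ε : ℝ) : EReal) ≤ c}) ≤ densityMeasure f J

section Window

variable {f g : ℝ → ℝ}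

theorem isWindow_empty (f g : ℝ → ℝ) (δ ε : ℝ) {c : EReal} (hc : c = ⊥ ∨ c = ⊤) :
    IsWindow f g δ ε c c ∅ where
  measurableSet := MeasurableSet.empty
  near := fun _ hx => hx.elim
  lt_of_le := fun x _ h => by
    rcases hc with rfl | rfl
    · exact EReal.bot_lt_coe x
    · exact absurd h (not_le.2 (EReal.coe_lt_top _))
  lt_of_ge := fun x _ h => by
    rcases hc with rfl | rfl
    · exact EReal.bot_lt_coe _
    · exact absurd h (not_le.2 (EReal.coe_lt_top _))
  exists_isShortCoupling := ⟨0, by simp, by simp, by simp⟩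
  measure_le := by simp

theorem IsWindow.mono {δ δ' ε : ℝ} {c₀ c : EReal} {J : Set ℝ} (h : IsWindow f g δ ε c₀ c J)
    (hδ : δ ≤ δ') : IsWindow f g δ' ε c₀ c J :=
  { h with near := fun x hx => (h.near x hx).imp fun _ hr => ⟨hr.1, hr.2.trans hδ⟩ }

theorem IsBalancedWindow.measure_add_measure_le {c δ ε t q p : ℝ}
    (hw : IsBalancedWindow f g c δ ε t q p) (hf : Continuous f) (hg : Continuous g)
    (hf₀ : ∀ x, 0 ≤ f x) (hg₀ : ∀ x, 0 ≤ g x) (hε : 0 ≤ ε) :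
    densityMeasure f (Icc (t - ε) p) + densityMeasure g (Icc q (t + ε)) ≤
      densityMeasure f (Icc q p) := by
  have hqt := hw.left_le_sub
  have htp := hw.add_le_right
  rw [densityMeasure_Icc hf hf₀ (by linarith), densityMeasure_Icc hg hg₀ (by linarith),
    densityMeasure_Icc hf hf₀ (by linarith), ← hw.integral_left, ← ENNReal.ofReal_add
      (integral_nonneg (by linarith) fun x _ => hf₀ x)
      (integral_nonneg (by linarith) fun x _ => hf₀ x), add_comm,
    integral_add_adjacent_intervals (hf.intervalIntegrable _ _) (hf.intervalIntegrable _ _)]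

theorem IsBalancedWindow.isWindow {c δ ε t q p : ℝ} (hw : IsBalancedWindow f g c δ ε t q p)
    (h : IsUpcrossing f g c δ) (hf₀ : ∀ x, 0 ≤ f x) (hg₀ : ∀ x, 0 ≤ g x) (hε : 0 ≤ ε)
    (ht : g (t + ε) = f (t - ε)) : IsWindow f g δ ε c t (Icc q p) := by
  have ⟨hqt, hqc, hδq, _, htp, hcp, hpδ, _⟩ := hw
  refine ⟨measurableSet_Icc, fun x hx => ⟨c, rfl, ?_⟩, fun x hx hle => ?_, fun x hx hle => ?_,
    hw.exists_isShortCoupling h hf₀ hg₀ hε ht, ?_⟩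
  · exact abs_le.2 ⟨by linarith [hx.1], by linarith [hx.2]⟩
  · rw [EReal.coe_le_coe_iff] at hle
    rw [EReal.coe_lt_coe_iff]
    by_contra! hxc
    exact hx ⟨by linarith, by linarith⟩
  · rw [EReal.coe_le_coe_iff] at hle
    rw [EReal.coe_lt_coe_iff]
    by_contra! hxt
    exact hx ⟨by linarith, by linarith⟩
  · have hright : Icc q p ∩ {x | (t : EReal) ≤ ((x + ε : ℝ) : EReal)} = Icc (t - ε) p := by
      ext x
      simp only [mem_inter_iff, mem_Icc, mem_ofPred_eq, EReal.coe_le_coe_iff]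
      grind
    have hleft : Icc q p ∩ {x | ((x - ε : ℝ) : EReal) ≤ (t : EReal)} = Icc q (t + ε) := by
      ext x
      simp only [mem_inter_iff, mem_Icc, mem_ofPred_eq, EReal.coe_le_coe_iff]
      grind
    rw [hright, hleft]
    exact hw.measure_add_measure_le h.contDiff_left.continuous h.contDiff_right.continuous
      hf₀ hg₀ hε

theorem IsUpcrossing.eventually_forall_exists_isWindow {c δ : ℝ} (h : IsUpcrossing f g c δ)
    (hf₀ : ∀ x, 0 ≤ f x) (hg₀ : ∀ x, 0 ≤ g x) :
    ∀ᶠ T in 𝓝[>] 0, ∀ y : ℝ → ℝ, y 0 = c → IsCrossingCurve f g T y →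
      ∀ ε ∈ Icc 0 T, ∃ J, IsWindow f g δ ε c (y ε) J := by
  have hnear := h.eventually_exists_isBalancedWindow hf₀ hg₀
  rw [nhds_prod_eq] at hnear
  obtain ⟨P, hP, S, hS, hPS⟩ := eventually_prod_iff.1 hnear
  filter_upwards [eventually_forall_mem_Icc (hP.filter_mono nhdsWithin_le_nhds),
    h.eventually_forall_isCrossingCurve_mem hS] with T hT hyS y hy₀ hy ε hε
  obtain ⟨q, p, hw⟩ := hPS (hT ε hε) (hyS y hy₀ hy ε hε) hε.1
  have hbalance := hy.balance_eq (h.contDiff_left.differentiable one_ne_zero)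
    (h.contDiff_right.differentiable one_ne_zero) hε
  rw [hy₀, h.eq, sub_self, sub_eq_zero] at hbalance
  exact ⟨_, hw.isWindow h hf₀ hg₀ hε.1 hbalance⟩

theorem eventually_crossingEvolves (hf : ContDiff ℝ 1 f) (hg : ContDiff ℝ 1 g)
    (hf₀ : ∀ x, 0 ≤ f x) (hg₀ : ∀ x, 0 ≤ g x) {c₀ : EReal}
    (hc₀ : ∀ r : ℝ, c₀ = r → f r = g r ∧ deriv f r < deriv g r) {δ : ℝ} (hδ : 0 < δ) :
    ∀ᶠ T in 𝓝[>] 0, (∃ c, CrossingEvolves f g T c₀ c) ∧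
      ∀ c, CrossingEvolves f g T c₀ c → ∀ ε ∈ Icc 0 T, ∃ J, IsWindow f g δ ε c₀ (c ε) J := by
  by_cases hinf : c₀ = ⊥ ∨ c₀ = ⊤
  · refine Eventually.of_forall fun T => ⟨⟨fun _ => c₀, Or.inl ⟨hinf, fun _ _ => rfl⟩⟩, ?_⟩
    rintro c (⟨-, hc⟩ | ⟨y, hy, -⟩) ε hε
    · exact ⟨∅, by rw [hc ε hε]; exact isWindow_empty f g δ ε hinf⟩
    · rcases hinf with h | h <;> simp [hy] at h
  · push Not at hinf
    lift c₀ to ℝ using ⟨hinf.2, hinf.1⟩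
    obtain ⟨heq, hlt⟩ := hc₀ c₀ rfl
    obtain ⟨δ', hδ', h⟩ := exists_isUpcrossing hf hg heq hlt hδ
    obtain ⟨y, hy₀, hy⟩ := exists_eventually_isCrossingCurve hf hg hlt.ne
    filter_upwards [hy, h.eventually_forall_exists_isWindow hf₀ hg₀] with T hyT hwindow
    refine ⟨⟨fun ε => (y ε : EReal), Or.inr ⟨y, by rw [hy₀], fun _ _ => rfl, hyT⟩⟩, ?_⟩
    rintro c (⟨h, -⟩ | ⟨z, hz₀, hcz, hz⟩) ε hε
    · exact absurd h (by simp)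
    · obtain ⟨J, hJ⟩ := hwindow z (by exact_mod_cast hz₀.symm) hz ε hε
      exact ⟨J, by rw [hcz ε hε]; exact hJ.mono hδ'⟩

end Window

/-! ### The boundary of a Bayes classifier -/

/-- The interval `(a, b)`, with endpoints in `[-∞, +∞]`, is a connected component of the open set
`U`: it is contained in `U`, and its finite endpoints are not in `U`. -/
structure IsComponent (U : Set ℝ) (a b : EReal) : Prop where
  lt : a < b
  mem : ∀ x : ℝ, a < x → x < b → x ∈ U
  left_notMem : ∀ r : ℝ, a = r → r ∉ U
  right_notMem : ∀ r : ℝ, b = r → r ∉ U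

theorem exists_isComponent {U : Set ℝ} (hU : IsOpen U) {x : ℝ} (hx : x ∈ U) :
    ∃ a b, IsComponent U a b ∧ a < x ∧ x < b := by
  let C : Set EReal := ((↑) '' U)ᶜ
  have hC : IsClosed C := (EReal.isOpenEmbedding_coe.isOpenMap U hU).isClosed_compl
  have hmemC : ∀ y : ℝ, (y : EReal) ∉ C → y ∈ U := fun y hy => by
    obtain ⟨z, hz, hzy⟩ := not_not.1 hy
    rwa [← EReal.coe_injective hzy]
  have hxC : (x : EReal) ∉ C := fun h => h ⟨x, hx, rfl⟩
  obtain ⟨a, ⟨haC, hax⟩, ha⟩ := (hC.inter isClosed_Iic).isCompact.exists_isGreatest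
    (⟨⊥, by simp [C], mem_Iic.2 bot_le⟩ : (C ∩ Iic (x : EReal)).Nonempty)
  obtain ⟨b, ⟨hbC, hxb⟩, hb⟩ := (hC.inter isClosed_Ici).isCompact.exists_isLeast
    (⟨⊤, by simp [C], mem_Ici.2 le_top⟩ : (C ∩ Ici (x : EReal)).Nonempty)
  have hax' : a < x := lt_of_le_of_ne hax fun h => hxC (h ▸ haC)
  have hxb' : x < b := lt_of_le_of_ne hxb fun h => hxC (h ▸ hbC)
  refine ⟨a, b, ⟨hax'.trans hxb', fun y hay hyb => hmemC y fun hy => ?_, ?_, ?_⟩, hax', hxb'⟩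
  · rcases le_total (y : EReal) x with hyx | hxy
    · exact hay.not_ge (ha ⟨hy, hyx⟩)
    · exact hyb.not_ge (hb ⟨hy, hxy⟩)
  · rintro r rfl hr
    exact haC ⟨r, hr, rfl⟩
  · rintro r rfl hr
    exact hbC ⟨r, hr, rfl⟩

namespace IsComponent

variable {U : Set ℝ} {a b a' b' : EReal}

theorem right_le_left (h : IsComponent U a b) (h' : IsComponent U a' b') (hlt : a < a') :
    b ≤ a' := by
  by_contra! hlt'
  lift a' to ℝ using ⟨(hlt'.trans_le le_top).ne, (bot_le.trans_lt hlt).ne'⟩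
  exact h'.left_notMem a' rfl (h.mem a' hlt hlt')

theorem mem_nhdsGT {r : ℝ} (h : IsComponent U r b) : U ∈ 𝓝[>] r := by
  have hlt : ∀ᶠ x : ℝ in 𝓝 r, (x : EReal) < b :=
    continuous_coe_real_ereal.continuousAt.eventually_lt continuousAt_const h.lt
  filter_upwards [self_mem_nhdsWithin, hlt.filter_mono nhdsWithin_le_nhds] with x hx hxb
  exact h.mem x (EReal.coe_lt_coe_iff.2 hx) hxb

theorem mem_nhdsLT {r : ℝ} (h : IsComponent U a r) : U ∈ 𝓝[<] r := by
  have hlt : ∀ᶠ x : ℝ in 𝓝 r, a < (x : EReal) :=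
    continuousAt_const.eventually_lt continuous_coe_real_ereal.continuousAt h.lt
  filter_upwards [self_mem_nhdsWithin, hlt.filter_mono nhdsWithin_le_nhds] with x hx hax
  exact h.mem x hax (EReal.coe_lt_coe_iff.2 hx)

end IsComponent

theorem mem_closure_of_mem_of_le_nhds {U : Set ℝ} {r : ℝ} {l : Filter ℝ} [l.NeBot] (hl : l ≤ 𝓝 r)
    (hU : U ∈ l) : r ∈ closure U :=
  mem_closure_iff_clusterPt.2 (NeBot.mono ‹_› (le_inf hl (le_principal_iff.2 hU)))

namespace IsComponent

variable {U : Set ℝ} {a b : EReal}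

theorem left_mem_frontier {r : ℝ} (h : IsComponent U r b) (hU : IsOpen U) : r ∈ frontier U :=
  hU.frontier_eq ▸ ⟨mem_closure_of_mem_of_le_nhds nhdsWithin_le_nhds h.mem_nhdsGT,
    h.left_notMem r rfl⟩

theorem finite_setOf_left (hU : IsOpen U) (hfin : (frontier U).Finite) :
    {a | ∃ b, IsComponent U a b}.Finite := by
  refine ((hfin.image ((↑) : ℝ → EReal)).insert ⊥).subset ?_
  rintro a ⟨b, h⟩
  induction a with
  | bot => exact mem_insert _ _
  | top => exact absurd h.lt not_top_lt
  | coe r => exact mem_insert_of_mem _ ⟨r, h.left_mem_frontier hU, rfl⟩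

theorem right_lt_left {a' b' : EReal} (h : IsComponent U a b) (h' : IsComponent U a' b')
    (hlt : a < a') (hole : ∀ r ∉ U, U ∈ 𝓝[<] r → U ∉ 𝓝[>] r) : b < a' := by
  refine lt_of_le_of_ne (h.right_le_left h' hlt) ?_
  rintro rfl
  lift b to ℝ using ⟨(h'.lt.trans_le le_top).ne, (bot_le.trans_lt hlt).ne'⟩
  exact hole b (h.right_notMem b rfl) h.mem_nhdsLT h'.mem_nhdsGT

end IsComponent

theorem exists_isBoundary_of_finite_frontier {A : Set ℝ} (hfin : (frontier (interior A)).Finite)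
    (hole : ∀ r ∉ interior A, interior A ∈ 𝓝[<] r → interior A ∉ 𝓝[>] r) :
    ∃ (K : ℕ) (a b : Fin K → EReal), IsBoundary A a b := by
  have hL := IsComponent.finite_setOf_left isOpen_interior hfin
  let a := hL.toFinset.orderEmbOfFin rfl
  have ha : range a = {a | ∃ b, IsComponent (interior A) a b} := by
    rw [Finset.range_orderEmbOfFin, hL.coe_toFinset]
  choose b hb using fun i => ha.subset (mem_range_self i)
  refine ⟨_, a, b, fun i => (hb i).lt,
    fun i j hij => (hb i).right_lt_left (hb j) (a.strictMono hij) hole, ?_⟩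
  refine Subset.antisymm (fun x ⟨i, hax, hxb⟩ => (hb i).mem x hax hxb) fun x hx => ?_
  obtain ⟨a', b', h, hax, hxb⟩ := exists_isComponent isOpen_interior hx
  obtain ⟨i, rfl⟩ := ha.superset ⟨b', h⟩
  refine ⟨i, hax, lt_of_not_ge fun hbx => ?_⟩
  have hbi : b i < b' := hbx.trans_lt hxb
  lift b i to ℝ using ⟨(hbi.trans_le le_top).ne, (bot_le.trans_lt (hb i).lt).ne'⟩ with r hr
  exact (hb i).right_notMem r hr.symm (h.mem r (hr ▸ (hb i).lt) hbi)

namespace IsBoundary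

variable {A : Set ℝ} {K : ℕ} {a b : Fin K → EReal}

theorem left_lt_left (h : IsBoundary A a b) {i j : Fin K} (hij : i < j) : a i < a j :=
  (h.lt i).trans (h.lt_of_lt i j hij)

theorem right_lt_right (h : IsBoundary A a b) {i j : Fin K} (hij : i < j) : b i < b j :=
  (h.lt_of_lt i j hij).trans (h.lt j)

theorem isComponent (h : IsBoundary A a b) (i : Fin K) :
    IsComponent (interior A) (a i) (b i) := by
  refine ⟨h.lt i, fun x hax hxb => h.union_eq ▸ ⟨i, hax, hxb⟩, fun r hr hrA => ?_,
    fun r hr hrA => ?_⟩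
  · obtain ⟨j, haj, hjb⟩ := h.union_eq.superset hrA
    rw [← hr] at haj hjb
    rcases lt_trichotomy i j with hij | rfl | hij
    · exact (h.left_lt_left hij).not_gt haj
    · exact haj.false
    · exact (h.lt_of_lt j i hij).not_gt hjb
  · obtain ⟨j, haj, hjb⟩ := h.union_eq.superset hrA
    rw [← hr] at haj hjb
    rcases lt_trichotomy i j with hij | rfl | hij
    · exact (h.lt_of_lt i j hij).not_gt haj
    · exact hjb.false
    · exact (h.right_lt_right hij).not_gt hjb

end IsBoundary

theorem hasDerivAt_nonneg_of_eventually_nhdsGT {h : ℝ → ℝ} {h' r : ℝ} (hd : HasDerivAt h h' r)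
    (hr : h r = 0) (hnonneg : ∀ᶠ x in 𝓝[>] r, 0 ≤ h x) : 0 ≤ h' := by
  refine ge_of_tendsto ((hasDerivAt_iff_tendsto_slope.1 hd).mono_left (nhdsGT_le_nhdsNE r)) ?_
  filter_upwards [hnonneg, self_mem_nhdsWithin] with x hx hrx
  rw [slope_def_field, hr, sub_zero]
  exact div_nonneg hx (sub_nonneg.2 (le_of_lt hrx))

theorem hasDerivAt_nonpos_of_eventually_nhdsLT {h : ℝ → ℝ} {h' r : ℝ} (hd : HasDerivAt h h' r)
    (hr : h r = 0) (hnonneg : ∀ᶠ x in 𝓝[<] r, 0 ≤ h x) : h' ≤ 0 := by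
  refine le_of_tendsto ((hasDerivAt_iff_tendsto_slope.1 hd).mono_left (nhdsLT_le_nhdsNE r)) ?_
  filter_upwards [hnonneg, self_mem_nhdsWithin] with x hx hxr
  rw [slope_def_field, hr, sub_zero]
  exact div_nonpos_of_nonneg_of_nonpos hx (sub_nonpos.2 (le_of_lt hxr))

theorem eq_of_mem_frontier_of_le {f g : ℝ → ℝ} {A : Set ℝ} (hf : Continuous f) (hg : Continuous g)
    (hmem : ∀ x ∈ A, f x ≤ g x) (hnotMem : ∀ x ∉ A, g x ≤ f x) {x : ℝ} (hx : x ∈ frontier A) :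
    f x = g x := by
  rw [frontier_eq_closure_inter_closure] at hx
  exact le_antisymm (le_on_closure hmem hf.continuousOn hg.continuousOn hx.1)
    (le_on_closure hnotMem hg.continuousOn hf.continuousOn hx.2)

/-- `A` is the region of the class `1` in a Bayes classification of two classes with weighted
densities `f` and `g`, and these cross transversally at the finitely many boundary points of `A`. -/
structure IsTransversalBayesSet (f g : ℝ → ℝ) (A : Set ℝ) : Prop where
  differentiable_left : Differentiable ℝ f
  differentiable_right : Differentiable ℝ g
  le_of_mem : ∀ x ∈ A, f x ≤ g x
  le_of_notMem : ∀ x ∉ A, g x ≤ f x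
  finite_frontier : (frontier A).Finite
  deriv_ne : ∀ x ∈ frontier A, deriv f x ≠ deriv g x

namespace IsTransversalBayesSet

variable {f g : ℝ → ℝ} {A : Set ℝ}

theorem le_of_notMem_interior (h : IsTransversalBayesSet f g A) {x : ℝ} (hx : x ∉ interior A) :
    g x ≤ f x :=
  le_on_closure (s := Aᶜ) h.le_of_notMem h.differentiable_right.continuous.continuousOn
    h.differentiable_left.continuous.continuousOn (by rwa [closure_compl])

theorem eq_of_mem_frontier (h : IsTransversalBayesSet f g A) {x : ℝ} (hx : x ∈ frontier A) :
    f x = g x :=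
  eq_of_mem_frontier_of_le h.differentiable_left.continuous h.differentiable_right.continuous
    h.le_of_mem h.le_of_notMem hx

theorem hasDerivAt_sub (h : IsTransversalBayesSet f g A) (r : ℝ) :
    HasDerivAt (fun x => g x - f x) (deriv g r - deriv f r) r :=
  (h.differentiable_right r).hasDerivAt.sub (h.differentiable_left r).hasDerivAt

theorem eq_and_deriv_lt_of_mem_nhdsGT (h : IsTransversalBayesSet f g A) {r : ℝ}
    (hr : r ∉ interior A) (hA : interior A ∈ 𝓝[>] r) : f r = g r ∧ deriv f r < deriv g r := by
  have hfr : r ∈ frontier A :=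
    ⟨closure_mono interior_subset (mem_closure_of_mem_of_le_nhds nhdsWithin_le_nhds hA), hr⟩
  have heq := h.eq_of_mem_frontier hfr
  have hnonneg : ∀ᶠ x in 𝓝[>] r, 0 ≤ g x - f x :=
    mem_of_superset hA fun x hx => sub_nonneg.2 (h.le_of_mem x (interior_subset hx))
  have hderiv := hasDerivAt_nonneg_of_eventually_nhdsGT (h.hasDerivAt_sub r)
    (sub_eq_zero.2 heq.symm) hnonneg
  exact ⟨heq, (sub_nonneg.1 hderiv).lt_of_ne (h.deriv_ne r hfr)⟩

theorem eq_and_deriv_lt_of_mem_nhdsLT (h : IsTransversalBayesSet f g A) {r : ℝ}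
    (hr : r ∉ interior A) (hA : interior A ∈ 𝓝[<] r) : g r = f r ∧ deriv g r < deriv f r := by
  have hfr : r ∈ frontier A :=
    ⟨closure_mono interior_subset (mem_closure_of_mem_of_le_nhds nhdsWithin_le_nhds hA), hr⟩
  have heq := h.eq_of_mem_frontier hfr
  have hnonneg : ∀ᶠ x in 𝓝[<] r, 0 ≤ g x - f x :=
    mem_of_superset hA fun x hx => sub_nonneg.2 (h.le_of_mem x (interior_subset hx))
  have hderiv := hasDerivAt_nonpos_of_eventually_nhdsLT (h.hasDerivAt_sub r)
    (sub_eq_zero.2 heq.symm) hnonneg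
  exact ⟨heq.symm, (sub_nonpos.1 hderiv).lt_of_ne (h.deriv_ne r hfr).symm⟩

theorem exists_isBoundary (h : IsTransversalBayesSet f g A) :
    ∃ (K : ℕ) (a b : Fin K → EReal), IsBoundary A a b :=
  exists_isBoundary_of_finite_frontier (h.finite_frontier.subset frontier_interior_subset)
    fun _ hr hleft hright => lt_asymm (h.eq_and_deriv_lt_of_mem_nhdsLT hr hleft).2
      (h.eq_and_deriv_lt_of_mem_nhdsGT hr hright).2

variable {K : ℕ} {a b : Fin K → EReal}

theorem crossing_of_left_eq (h : IsTransversalBayesSet f g A) (hB : IsBoundary A a b) {i : Fin K}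
    {r : ℝ} (hr : a i = r) : f r = g r ∧ deriv f r < deriv g r := by
  have hi := hB.isComponent i
  rw [hr] at hi
  exact h.eq_and_deriv_lt_of_mem_nhdsGT (hi.left_notMem r rfl) hi.mem_nhdsGT

theorem crossing_of_right_eq (h : IsTransversalBayesSet f g A) (hB : IsBoundary A a b) {i : Fin K}
    {r : ℝ} (hr : b i = r) : g r = f r ∧ deriv g r < deriv f r := by
  have hi := hB.isComponent i
  rw [hr] at hi
  exact h.eq_and_deriv_lt_of_mem_nhdsLT (hi.right_notMem r rfl) hi.mem_nhdsLT

end IsTransversalBayesSet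

/-! ### Gluing couplings on disjoint sets -/

namespace IsShortCoupling

variable {X : Type*} [MeasurableSpace X] [PseudoMetricSpace X] {η : ℝ}

theorem sum {ι : Type*} [Fintype ι] {μ ν : ι → Measure X} {σ : ι → Measure (X × X)}
    (h : ∀ k, IsShortCoupling (μ k) (ν k) η (σ k)) :
    IsShortCoupling (∑ k, μ k) (∑ k, ν k) η (∑ k, σ k) := by
  simp only [← Measure.sum_fintype]
  refine ⟨?_, ?_, Measure.ae_sum_iff.2 fun k => (h k).ae_dist_le⟩
  · simp only [Measure.fst_sum, (h _).fst_eq]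
  · simp only [Measure.snd_sum, (h _).snd_eq]

theorem add {μ ν μ' ν' : Measure X} {σ σ' : Measure (X × X)} (h : IsShortCoupling μ ν η σ)
    (h' : IsShortCoupling μ' ν' η σ') : IsShortCoupling (μ + μ') (ν + ν') η (σ + σ') :=
  ⟨by rw [Measure.fst_add, h.fst_eq, h'.fst_eq], by rw [Measure.snd_add, h.snd_eq, h'.snd_eq],
    ae_add_measure_iff.2 ⟨h.ae_dist_le, h'.ae_dist_le⟩⟩

theorem measure_univ_eq {μ ν : Measure X} {σ : Measure (X × X)} (h : IsShortCoupling μ ν η σ) :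
    μ univ = ν univ := by
  rw [← h.fst_eq, ← h.snd_eq, Measure.fst_univ, Measure.snd_univ]

variable [OpensMeasurableSpace X] [SecondCountableTopology X]

theorem swap {μ ν : Measure X} {σ : Measure (X × X)} (h : IsShortCoupling μ ν η σ) :
    IsShortCoupling ν μ η (σ.map Prod.swap) := by
  refine ⟨by rw [Measure.fst_map_swap, h.snd_eq], by rw [Measure.snd_map_swap, h.fst_eq], ?_⟩
  rw [ae_map_iff measurable_swap.aemeasurable (measurableSet_le measurable_dist measurable_const)]
  filter_upwards [h.ae_dist_le] with z hz
  rwa [Prod.fst_swap, Prod.snd_swap, dist_comm]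

theorem diagonal (μ : Measure X) (hη : 0 ≤ η) :
    IsShortCoupling μ μ η (μ.map fun x => (x, x)) := by
  have hdiag : Measurable fun x : X => (x, x) := measurable_id.prodMk measurable_id
  refine ⟨?_, ?_, ?_⟩
  · exact (Measure.fst_map_prodMk (X := id) measurable_id).trans Measure.map_id
  · exact (Measure.snd_map_prodMk (Y := id) measurable_id).trans Measure.map_id
  · rw [ae_map_iff hdiag.aemeasurable (measurableSet_le measurable_dist measurable_const)]
    exact ae_of_all _ fun x => by simpa only [dist_self] using hη

end IsShortCoupling

theorem sum_restrict_add_restrict_compl {X ι : Type*} [MeasurableSpace X] [Fintype ι]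
    (μ : Measure X) {J : ι → Set X} (hJ : ∀ k, MeasurableSet (J k))
    (hdisj : Pairwise (Function.onFun Disjoint J)) :
    ∑ k, μ.restrict (J k) + μ.restrict (⋃ k, J k)ᶜ = μ := by
  rw [← Measure.sum_fintype, ← Measure.restrict_iUnion hdisj hJ,
    Measure.restrict_add_restrict_compl (MeasurableSet.iUnion hJ)]

theorem sum_measure_inter_add_measure_compl_inter {X ι : Type*} [MeasurableSpace X] [Fintype ι]
    (μ : Measure X) {J : ι → Set X} (hJ : ∀ k, MeasurableSet (J k))
    (hdisj : Pairwise (Function.onFun Disjoint J)) {s : Set X} (hs : MeasurableSet s) :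
    ∑ k, μ (J k ∩ s) + μ ((⋃ k, J k)ᶜ ∩ s) = μ s := by
  conv_rhs => rw [← sum_restrict_add_restrict_compl μ hJ hdisj]
  simp only [Measure.add_apply, Measure.finsetSum_apply, Measure.restrict_apply hs, inter_comm s]

theorem exists_matching_of_isShortCoupling {X ι : Type*} [MeasurableSpace X]
    [PseudoMetricSpace X] [OpensMeasurableSpace X] [SecondCountableTopology X] [Fintype ι]
    {μ ν m : Measure X} {η : ℝ} (hη : 0 ≤ η) {J : ι → Set X} (hJ : ∀ k, MeasurableSet (J k))
    (hdisj : Pairwise (Function.onFun Disjoint J))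
    (h : ∀ k, ∃ σ, IsShortCoupling (μ.restrict (J k)) (ν.restrict (J k)) η σ)
    (hμ : m ≤ μ) (hν : m ≤ ν) :
    ∃ τ : Measure (X × X), τ.fst ≤ μ ∧ τ.snd ≤ ν ∧ (∀ᵐ z ∂τ, dist z.1 z.2 ≤ η) ∧
      τ univ = ∑ k, μ (J k) + m (⋃ k, J k)ᶜ := by
  choose σ hσ using h
  have hτ := (IsShortCoupling.sum hσ).add
    (IsShortCoupling.diagonal (m.restrict (⋃ k, J k)ᶜ) hη)
  refine ⟨_, ?_, ?_, hτ.ae_dist_le, ?_⟩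
  · refine hτ.fst_eq.trans_le (le_of_le_of_eq ?_ (sum_restrict_add_restrict_compl μ hJ hdisj))
    gcongr
  · refine hτ.snd_eq.trans_le (le_of_le_of_eq ?_ (sum_restrict_add_restrict_compl ν hJ hdisj))
    gcongr
  · rw [← Measure.fst_univ, hτ.fst_eq]
    simp only [Measure.add_apply, Measure.finsetSum_apply, Measure.restrict_apply_univ]

section Density

variable {f g : ℝ → ℝ}

theorem densityMeasure_mono (h : ∀ x, f x ≤ g x) : densityMeasure f ≤ densityMeasure g :=
  withDensity_mono (ae_of_all _ fun x => ENNReal.ofReal_le_ofReal (h x))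

theorem densityMeasure_le_of_forall_mem {s : Set ℝ} (hs : MeasurableSet s)
    (h : ∀ x ∈ s, f x ≤ g x) : densityMeasure f s ≤ densityMeasure g s := by
  rw [densityMeasure_apply hs, densityMeasure_apply hs]
  exact setLIntegral_mono' hs fun x hx => ENNReal.ofReal_le_ofReal (h x hx)

theorem densityMeasure_add_le_densityMeasure_min {s t : Set ℝ} (hs : MeasurableSet s)
    (ht : MeasurableSet t) (hst : Disjoint s t) (hfg : ∀ x ∈ s, f x ≤ g x)
    (hgf : ∀ x ∈ t, g x ≤ f x) :
    densityMeasure f s + densityMeasure g t ≤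
      densityMeasure (fun x => min (f x) (g x)) (s ∪ t) := by
  rw [measure_union hst ht]
  exact add_le_add
    (densityMeasure_le_of_forall_mem hs fun x hx => le_min le_rfl (hfg x hx))
    (densityMeasure_le_of_forall_mem ht fun x hx => le_min (hgf x hx) le_rfl)

theorem exists_matching_of_forall_measure_add_le {ι : Type*} [Finite ι] {η : ℝ} (hη : 0 ≤ η)
    {J : ι → Set ℝ} (hJ : ∀ k, MeasurableSet (J k))
    (hdisj : Pairwise (Function.onFun Disjoint J))
    (h : ∀ k, ∃ σ, IsShortCoupling ((densityMeasure f).restrict (J k))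
      ((densityMeasure g).restrict (J k)) η σ)
    {P Q : Set ℝ} (hP : MeasurableSet P) (hQ : MeasurableSet Q)
    (hle : ∀ k, densityMeasure f (J k ∩ P) + densityMeasure g (J k ∩ Q) ≤ densityMeasure f (J k))
    (hPQ : Disjoint ((⋃ k, J k)ᶜ ∩ P) ((⋃ k, J k)ᶜ ∩ Q))
    (hfg : ∀ x ∈ (⋃ k, J k)ᶜ ∩ P, f x ≤ g x) (hgf : ∀ x ∈ (⋃ k, J k)ᶜ ∩ Q, g x ≤ f x) :
    ∃ τ : Measure (ℝ × ℝ), τ.fst ≤ densityMeasure f ∧ τ.snd ≤ densityMeasure g ∧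
      (∀ᵐ z ∂τ, dist z.1 z.2 ≤ η) ∧ densityMeasure f P + densityMeasure g Q ≤ τ univ := by
  cases nonempty_fintype ι
  have hO : MeasurableSet (⋃ k, J k)ᶜ := (MeasurableSet.iUnion hJ).compl
  obtain ⟨τ, hfst, hsnd, hdist, hτ⟩ := exists_matching_of_isShortCoupling hη hJ hdisj h
    (densityMeasure_mono fun x => min_le_left (f x) (g x))
    (densityMeasure_mono fun x => min_le_right (f x) (g x))
  refine ⟨τ, hfst, hsnd, hdist, ?_⟩
  rw [← sum_measure_inter_add_measure_compl_inter _ hJ hdisj hP,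
    ← sum_measure_inter_add_measure_compl_inter (densityMeasure g) hJ hdisj hQ,
    add_add_add_comm, ← Finset.sum_add_distrib, hτ]
  refine add_le_add (Finset.sum_le_sum fun k _ => hle k) ?_
  exact (densityMeasure_add_le_densityMeasure_min (hO.inter hP) (hO.inter hQ) hPQ hfg hgf).trans
    (measure_mono (union_subset inter_subset_left inter_subset_left))

end Density

/-! ### Matching the two classes -/

/-- The union of the closed `ε`-neighbourhoods of the intervals `[a i, b i]`. -/
def dilatedIntervals {K : ℕ} (a b : Fin K → EReal) (ε : ℝ) : Set ℝ :=
  {x | ∃ i, a i ≤ ((x + ε : ℝ) : EReal) ∧ ((x - ε : ℝ) : EReal) ≤ b i}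

/-- The points whose closed `ε`-neighbourhood lies inside one of the intervals `(a i, b i)`. -/
def erodedIntervals {K : ℕ} (a b : Fin K → EReal) (ε : ℝ) : Set ℝ :=
  {x | ∃ i, a i < ((x - ε : ℝ) : EReal) ∧ ((x + ε : ℝ) : EReal) < b i}

section Interval

variable {K : ℕ} (a b : Fin K → EReal) (ε : ℝ)

theorem measurableSet_dilatedIntervals : MeasurableSet (dilatedIntervals a b ε) := by
  simp only [dilatedIntervals, ofPred_exists]
  measurability

theorem measurableSet_erodedIntervals : MeasurableSet (erodedIntervals a b ε) := by
  simp only [erodedIntervals, ofPred_exists]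
  measurability

end Interval

theorem eventually_add_two_mul_lt {u v : EReal} (h : u < v) :
    ∀ᶠ δ in 𝓝[>] (0 : ℝ), u + (2 * δ : ℝ) < v := by
  have hcont : ContinuousAt (fun δ : ℝ => u + ((2 * δ : ℝ) : EReal)) 0 :=
    (EReal.continuousAt_add (p := (u, ((2 * 0 : ℝ) : EReal))) (by simp) (by simp)).comp
      (f := fun δ : ℝ => (u, ((2 * δ : ℝ) : EReal)))
      (continuous_const.prodMk (continuous_coe_real_ereal.comp (by fun_prop))).continuousAt
  exact (hcont.eventually_lt_const (by simpa using h)).filter_mono nhdsWithin_le_nhds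

namespace IsWindow

variable {f g f' g' : ℝ → ℝ} {δ ε : ℝ} {c₀ c d₀ d : EReal} {J J' : Set ℝ}

theorem measure_eq (h : IsWindow f g δ ε c₀ c J) : densityMeasure f J = densityMeasure g J := by
  obtain ⟨σ, hσ⟩ := h.exists_isShortCoupling
  simpa only [Measure.restrict_apply_univ] using hσ.measure_univ_eq

theorem coe_add_lt_of_mem (h : IsWindow f g δ ε c₀ c J) (hs : c₀ + (2 * δ : ℝ) < d₀) {x : ℝ}
    (hx : x ∈ J) : ((x + δ : ℝ) : EReal) < d₀ := by
  obtain ⟨r, rfl, hr⟩ := h.near x hx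
  refine lt_of_le_of_lt ?_ hs
  rw [← EReal.coe_add, EReal.coe_le_coe_iff]
  linarith [(abs_le.1 hr).2]

theorem lt_coe_sub_of_mem (h : IsWindow f g δ ε c₀ c J) (hs : d₀ + (2 * δ : ℝ) < c₀) {x : ℝ}
    (hx : x ∈ J) : d₀ < ((x - δ : ℝ) : EReal) := by
  obtain ⟨r, rfl, hr⟩ := h.near x hx
  induction d₀ with
  | bot => exact EReal.bot_lt_coe _
  | top =>
    rw [EReal.top_add_coe] at hs
    exact absurd hs not_top_lt
  | coe s =>
    rw [← EReal.coe_add, EReal.coe_lt_coe_iff] at hs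
    rw [EReal.coe_lt_coe_iff]
    linarith [(abs_le.1 hr).1]

theorem disjoint (h : IsWindow f g δ ε c₀ c J) (h' : IsWindow f' g' δ ε d₀ d J')
    (hs : c₀ + (2 * δ : ℝ) < d₀) : Disjoint J J' := by
  refine Set.disjoint_left.2 fun x hx hx' => ?_
  have hlt := h.coe_add_lt_of_mem hs hx
  obtain ⟨r, rfl, hr⟩ := h'.near x hx'
  rw [EReal.coe_lt_coe_iff] at hlt
  linarith [(abs_le.1 hr).1]

theorem add_lt_of_mem (h : IsWindow f g δ ε c₀ c J) (h' : IsWindow f' g' δ ε d₀ d J')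
    (hδ : 0 ≤ δ) (hs : c₀ + (2 * δ : ℝ) < d₀) {x : ℝ} (hx : x ∈ J) :
    ((x + ε : ℝ) : EReal) < d := by
  have hxd : (x : EReal) < d₀ :=
    (EReal.coe_le_coe_iff.2 (by linarith)).trans_lt (h.coe_add_lt_of_mem hs hx)
  exact lt_of_not_ge fun hle =>
    hxd.asymm (h'.lt_of_le x (disjoint_left.1 (h.disjoint h' hs) hx) hle)

theorem lt_sub_of_mem (h : IsWindow f g δ ε c₀ c J) (h' : IsWindow f' g' δ ε d₀ d J')
    (hδ : 0 ≤ δ) (hs : d₀ + (2 * δ : ℝ) < c₀) {x : ℝ} (hx : x ∈ J) :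
    d < ((x - ε : ℝ) : EReal) := by
  have hdx : d₀ ≤ (x : EReal) :=
    (h.lt_coe_sub_of_mem hs hx).le.trans (EReal.coe_le_coe_iff.2 (by linarith))
  exact h'.lt_of_ge x (disjoint_right.1 (h'.disjoint h hs) hx) hdx

end IsWindow

/-- Windows around all the endpoints of a finite union of intervals, which has moved from the
endpoints `a₀`, `b₀` to `a`, `b`. Distinct endpoints are so far apart that the windows are disjoint.
At right endpoints the roles of `f` and `g` are exchanged. -/
structure IsWindowFamily (f g : ℝ → ℝ) (δ ε : ℝ) {K : ℕ} (a₀ b₀ a b : Fin K → EReal)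
    (Ja Jb : Fin K → Set ℝ) : Prop where
  pos : 0 < δ
  left : ∀ i, IsWindow f g δ ε (a₀ i) (a i) (Ja i)
  right : ∀ i, IsWindow g f δ ε (b₀ i) (b i) (Jb i)
  left_add_lt : ∀ i, a₀ i + (2 * δ : ℝ) < b₀ i
  right_add_lt : ∀ i j, i < j → b₀ i + (2 * δ : ℝ) < a₀ j

namespace IsWindowFamily

variable {f g : ℝ → ℝ} {δ ε : ℝ} {K : ℕ} {a₀ b₀ a b : Fin K → EReal} {Ja Jb : Fin K → Set ℝ}
  {i j : Fin K}

theorem le_add_two_mul (h : IsWindowFamily f g δ ε a₀ b₀ a b Ja Jb) (c : EReal) :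
    c ≤ c + (2 * δ : ℝ) :=
  le_add_of_nonneg_right (EReal.coe_nonneg.2 (mul_nonneg zero_le_two h.pos.le))

theorem left_add_lt_left (h : IsWindowFamily f g δ ε a₀ b₀ a b Ja Jb) (hij : i < j) :
    a₀ i + (2 * δ : ℝ) < a₀ j :=
  (h.left_add_lt i).trans ((h.le_add_two_mul _).trans_lt (h.right_add_lt i j hij))

theorem right_add_lt_right (h : IsWindowFamily f g δ ε a₀ b₀ a b Ja Jb) (hij : i < j) :
    b₀ i + (2 * δ : ℝ) < b₀ j :=
  (h.right_add_lt i j hij).trans ((h.le_add_two_mul _).trans_lt (h.left_add_lt j))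

theorem left_add_lt_right (h : IsWindowFamily f g δ ε a₀ b₀ a b Ja Jb) (hij : i ≤ j) :
    a₀ i + (2 * δ : ℝ) < b₀ j := by
  rcases hij.eq_or_lt with rfl | hij
  · exact h.left_add_lt i
  · exact (h.left_add_lt_left hij).trans ((h.le_add_two_mul _).trans_lt (h.left_add_lt j))

theorem disjoint_left_right (h : IsWindowFamily f g δ ε a₀ b₀ a b Ja Jb) (i j : Fin K) :
    Disjoint (Ja i) (Jb j) := by
  rcases le_or_gt i j with hij | hji
  · exact (h.left i).disjoint (h.right j) (h.left_add_lt_right hij)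
  · exact ((h.right j).disjoint (h.left i) (h.right_add_lt j i hji)).symm

theorem pairwise_disjoint (h : IsWindowFamily f g δ ε a₀ b₀ a b Ja Jb) :
    Pairwise (Function.onFun Disjoint (Sum.elim Ja Jb)) := by
  rintro (i | i) (j | j) hij
  · rcases lt_or_gt_of_ne (ne_of_apply_ne Sum.inl hij) with hij | hji
    · exact (h.left i).disjoint (h.left j) (h.left_add_lt_left hij)
    · exact ((h.left j).disjoint (h.left i) (h.left_add_lt_left hji)).symm
  · exact h.disjoint_left_right i j
  · exact (h.disjoint_left_right j i).symm
  · rcases lt_or_gt_of_ne (ne_of_apply_ne Sum.inr hij) with hij | hji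
    · exact (h.right i).disjoint (h.right j) (h.right_add_lt_right hij)
    · exact ((h.right j).disjoint (h.right i) (h.right_add_lt_right hji)).symm

theorem left_inter_dilatedIntervals_subset (h : IsWindowFamily f g δ ε a₀ b₀ a b Ja Jb)
    (i : Fin K) : Ja i ∩ dilatedIntervals a b ε ⊆ Ja i ∩ {x | a i ≤ ((x + ε : ℝ) : EReal)} := by
  rintro x ⟨hx, j, hj₁, hj₂⟩
  refine ⟨hx, ?_⟩
  rcases lt_trichotomy i j with hij | rfl | hji
  · exact absurd hj₁
      ((h.left i).add_lt_of_mem (h.left j) h.pos.le (h.left_add_lt_left hij) hx).not_ge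
  · exact hj₁
  · exact absurd hj₂
      ((h.left i).lt_sub_of_mem (h.right j) h.pos.le (h.right_add_lt j i hji) hx).not_ge

theorem right_inter_dilatedIntervals_subset (h : IsWindowFamily f g δ ε a₀ b₀ a b Ja Jb)
    (i : Fin K) : Jb i ∩ dilatedIntervals a b ε ⊆ Jb i ∩ {x | ((x - ε : ℝ) : EReal) ≤ b i} := by
  rintro x ⟨hx, j, hj₁, hj₂⟩
  refine ⟨hx, ?_⟩
  rcases lt_trichotomy i j with hij | rfl | hji
  · exact absurd hj₁
      ((h.right i).add_lt_of_mem (h.left j) h.pos.le (h.right_add_lt i j hij) hx).not_ge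
  · exact hj₂
  · exact absurd hj₂
      ((h.right i).lt_sub_of_mem (h.right j) h.pos.le (h.right_add_lt_right hji) hx).not_ge

theorem left_diff_erodedIntervals_subset (h : IsWindowFamily f g δ ε a₀ b₀ a b Ja Jb)
    (i : Fin K) :
    Ja i ∩ (erodedIntervals a b ε)ᶜ ⊆ Ja i ∩ {x | ((x - ε : ℝ) : EReal) ≤ a i} :=
  fun _ ⟨hx, hnot⟩ => ⟨hx, not_lt.1 fun hlt => hnot
    ⟨i, hlt, (h.left i).add_lt_of_mem (h.right i) h.pos.le (h.left_add_lt i) hx⟩⟩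

theorem right_diff_erodedIntervals_subset (h : IsWindowFamily f g δ ε a₀ b₀ a b Ja Jb)
    (i : Fin K) :
    Jb i ∩ (erodedIntervals a b ε)ᶜ ⊆ Jb i ∩ {x | b i ≤ ((x + ε : ℝ) : EReal)} :=
  fun _ ⟨hx, hnot⟩ => ⟨hx, not_lt.1 fun hlt => hnot
    ⟨i, (h.right i).lt_sub_of_mem (h.left i) h.pos.le (h.left_add_lt i) hx, hlt⟩⟩

theorem measure_inter_add_measure_diff_le (h : IsWindowFamily f g δ ε a₀ b₀ a b Ja Jb)
    (k : Fin K ⊕ Fin K) :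
    densityMeasure f (Sum.elim Ja Jb k ∩ dilatedIntervals a b ε) +
      densityMeasure g (Sum.elim Ja Jb k ∩ (erodedIntervals a b ε)ᶜ) ≤
        densityMeasure f (Sum.elim Ja Jb k) := by
  rcases k with i | i
  · exact (add_le_add (measure_mono (h.left_inter_dilatedIntervals_subset i))
      (measure_mono (h.left_diff_erodedIntervals_subset i))).trans (h.left i).measure_le
  · rw [add_comm]
    exact (add_le_add (measure_mono (h.right_diff_erodedIntervals_subset i))
      (measure_mono (h.right_inter_dilatedIntervals_subset i))).trans
        ((h.right i).measure_le.trans_eq (h.right i).measure_eq)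

theorem exists_isShortCoupling (h : IsWindowFamily f g δ ε a₀ b₀ a b Ja Jb) (k : Fin K ⊕ Fin K) :
    ∃ σ, IsShortCoupling ((densityMeasure f).restrict (Sum.elim Ja Jb k))
      ((densityMeasure g).restrict (Sum.elim Ja Jb k)) (2 * ε) σ := by
  rcases k with i | i
  · exact (h.left i).exists_isShortCoupling
  · obtain ⟨σ, hσ⟩ := (h.right i).exists_isShortCoupling
    exact ⟨_, hσ.swap⟩

theorem measurableSet (h : IsWindowFamily f g δ ε a₀ b₀ a b Ja Jb) (k : Fin K ⊕ Fin K) :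
    MeasurableSet (Sum.elim Ja Jb k) := by
  rcases k with i | i
  · exact (h.left i).measurableSet
  · exact (h.right i).measurableSet

theorem mem_intervalUnion_of_mem_dilatedIntervals (h : IsWindowFamily f g δ ε a₀ b₀ a b Ja Jb)
    {x : ℝ} (hx : x ∈ (⋃ k, Sum.elim Ja Jb k)ᶜ) (hdil : x ∈ dilatedIntervals a b ε) :
    x ∈ intervalUnion a₀ b₀ := by
  obtain ⟨i, hi₁, hi₂⟩ := hdil
  rw [compl_iUnion, mem_iInter] at hx
  exact ⟨i, (h.left i).lt_of_le x (hx (.inl i)) hi₁, not_le.1 fun hle =>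
    ((h.right i).lt_of_ge x (hx (.inr i)) hle).not_ge hi₂⟩

theorem mem_erodedIntervals_of_mem_intervalUnion (h : IsWindowFamily f g δ ε a₀ b₀ a b Ja Jb)
    {x : ℝ} (hx : x ∈ (⋃ k, Sum.elim Ja Jb k)ᶜ) (hmem : x ∈ intervalUnion a₀ b₀) :
    x ∈ erodedIntervals a b ε := by
  obtain ⟨i, hi₁, hi₂⟩ := hmem
  rw [compl_iUnion, mem_iInter] at hx
  exact ⟨i, (h.left i).lt_of_ge x (hx (.inl i)) hi₁.le, not_le.1 fun hle =>
    hi₂.asymm ((h.right i).lt_of_le x (hx (.inr i)) hle)⟩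

theorem exists_matching (h : IsWindowFamily f g δ ε a₀ b₀ a b Ja Jb) (hε : 0 ≤ ε)
    (hU : ∀ x ∈ intervalUnion a₀ b₀, f x ≤ g x) (hU' : ∀ x ∉ intervalUnion a₀ b₀, g x ≤ f x) :
    ∃ τ : Measure (ℝ × ℝ), τ.fst ≤ densityMeasure f ∧ τ.snd ≤ densityMeasure g ∧
      (∀ᵐ z ∂τ, dist z.1 z.2 ≤ 2 * ε) ∧
      densityMeasure f (dilatedIntervals a b ε) + densityMeasure g (erodedIntervals a b ε)ᶜ ≤
        τ univ := by
  have hdil := fun x hx => h.mem_intervalUnion_of_mem_dilatedIntervals (x := x) hx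
  have hero := fun x hx => mt (h.mem_erodedIntervals_of_mem_intervalUnion (x := x) hx)
  exact exists_matching_of_forall_measure_add_le (by positivity) h.measurableSet
    h.pairwise_disjoint h.exists_isShortCoupling (measurableSet_dilatedIntervals a b ε)
    (measurableSet_erodedIntervals a b ε).compl h.measure_inter_add_measure_diff_le
    (disjoint_left.2 fun x hP hQ => hero x hQ.1 hQ.2 (hdil x hP.1 hP.2))
    (fun x hx => hU x (hdil x hx.1 hx.2)) (fun x hx => hU' x (hero x hx.1 hx.2))

end IsWindowFamily

/-! ### Offsets of finite unions of intervals -/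

section IntervalUnion

variable {K : ℕ} (a b : Fin K → EReal)

theorem isOpen_intervalUnion : IsOpen (intervalUnion a b) := by
  simp only [intervalUnion, ofPred_exists]
  exact isOpen_iUnion fun i => (isOpen_lt continuous_const continuous_coe_real_ereal).inter
    (isOpen_lt continuous_coe_real_ereal continuous_const)

theorem closure_intervalUnion_subset :
    closure (intervalUnion a b) ⊆ {x | ∃ i, a i ≤ (x : EReal) ∧ (x : EReal) ≤ b i} := by
  refine closure_minimal (fun x ⟨i, hi₁, hi₂⟩ => ⟨i, hi₁.le, hi₂.le⟩) ?_
  simp only [ofPred_exists]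
  exact isClosed_iUnion_of_finite fun i =>
    (isClosed_le continuous_const continuous_coe_real_ereal).inter
      (isClosed_le continuous_coe_real_ereal continuous_const)

theorem finite_frontier_intervalUnion : (frontier (intervalUnion a b)).Finite := by
  refine (((finite_range a).union (finite_range b)).preimage
    EReal.coe_injective.injOn).subset fun x hx => ?_
  rw [(isOpen_intervalUnion a b).frontier_eq] at hx
  obtain ⟨i, hi₁, hi₂⟩ := closure_intervalUnion_subset a b hx.1
  rcases hi₁.eq_or_lt with hi₁ | hi₁
  · exact Or.inl ⟨i, hi₁⟩
  · exact Or.inr ⟨i, (hi₂.eq_of_not_lt fun hi₂ => hx.2 ⟨i, hi₁, hi₂⟩).symm⟩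

variable {ε : ℝ}

theorem offsetSet_intervalUnion_subset_dilatedIntervals (hε : 0 ≤ ε) :
    offsetSet (intervalUnion a b) ε ⊆ dilatedIntervals a b ε := by
  rw [offsetSet_of_nonneg _ hε, ← Metric.cthickening_closure,
    isClosed_closure.cthickening_eq_biUnion_closedBall hε]
  refine iUnion₂_subset fun y hy x hx => ?_
  obtain ⟨i, hi₁, hi₂⟩ := closure_intervalUnion_subset a b hy
  rw [Metric.mem_closedBall, Real.dist_eq, abs_le] at hx
  exact ⟨i, hi₁.trans (EReal.coe_le_coe_iff.2 (by linarith)),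
    (EReal.coe_le_coe_iff.2 (by linarith)).trans hi₂⟩

theorem erodedIntervals_subset_offsetSet_neg (hε : 0 ≤ ε) :
    erodedIntervals a b ε ⊆ offsetSet (intervalUnion a b) (-ε) := by
  have hnear : ∀ x ∈ erodedIntervals a b ε, ∀ y, dist x y ≤ ε → y ∈ intervalUnion a b := by
    rintro x ⟨i, hi₁, hi₂⟩ y hxy
    rw [Real.dist_eq, abs_le] at hxy
    exact ⟨i, hi₁.trans_le (EReal.coe_le_coe_iff.2 (by linarith)),
      (EReal.coe_le_coe_iff.2 (by linarith)).trans_lt hi₂⟩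
  intro x hx
  rcases hε.eq_or_lt with rfl | hε
  · rw [neg_zero, offsetSet_of_nonneg _ le_rfl]
    exact Metric.self_subset_cthickening _ (hnear x hx x (dist_self x).le)
  · rw [offsetSet_neg_of_pos _ hε]
    intro hthick
    obtain ⟨y, hy, hxy⟩ := Metric.mem_thickening_iff.1 hthick
    exact hy (hnear x hx y hxy.le)

end IntervalUnion

/-! ### Optimality -/

theorem isClosed_offsetSet (A : Set ℝ) (s : ℝ) : IsClosed (offsetSet A s) := by
  rcases le_or_gt 0 s with hs | hs
  · rw [offsetSet_of_nonneg A hs]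
    exact Metric.isClosed_cthickening
  · rw [← neg_neg s, offsetSet_neg_of_pos A (neg_pos.2 hs)]
    exact Metric.isOpen_thickening.isClosed_compl

theorem exists_coupling_and_isRobustOptimal_of_matching {μ : Fin 2 → Measure ℝ}
    [IsProbabilityMeasure (labelMeasure μ)] (hμ : ∀ y, μ y ≪ volume) {ε : ℝ} (hε : 0 ≤ ε)
    {A : Set ℝ} (hA : MeasurableSet A) (hfr : volume (frontier A) = 0) {σ : Measure (ℝ × ℝ)}
    (hfst : σ.fst ≤ μ 0) (hsnd : σ.snd ≤ μ 1) (hdist : ∀ᵐ z ∂σ, dist z.1 z.2 ≤ 2 * ε)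
    (hσ : μ 0 (offsetSet A ε) + μ 1 (offsetSet A (-ε))ᶜ ≤ σ univ) :
    (∃ π ∈ couplings (labelMeasure μ) (swapLabels (labelMeasure μ)),
      2 * (μ 0 (offsetSet A ε) + μ 1 (offsetSet A (-ε))ᶜ) + π (costlySet ε) = 1) ∧
    IsRobustOptimal (labelMeasure μ) ε A := by
  obtain ⟨π, hπ, hupper⟩ := exists_mem_couplings_two_mul_add_le μ hfst hsnd hdist
  have := hπ.1
  have hac : (labelMeasure μ).fst ≪ volume := by
    rw [fst_labelMeasure]
    exact (hμ 0).add_left (hμ 1)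
  have hrisk : robustRisk (labelMeasure μ) ε (classifier A) ≤
      μ 0 (offsetSet A ε) + μ 1 (offsetSet A (-ε))ᶜ :=
    (robustRisk_le_measure_vulnerableSet _ ε hA).trans (measure_vulnerableSet_le μ (hμ 1) hε hfr)
  have hdual : ∀ B, MeasurableSet B →
      1 ≤ 2 * robustRisk (labelMeasure μ) ε (classifier B) + π (costlySet ε) :=
    fun B hB => one_le_two_mul_robustRisk_add hac hε hπ hB
  have heq : 2 * (μ 0 (offsetSet A ε) + μ 1 (offsetSet A (-ε))ᶜ) + π (costlySet ε) = 1 :=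
    le_antisymm ((by gcongr : _ ≤ _).trans hupper) ((hdual A hA).trans (by gcongr))
  refine ⟨⟨π, hπ, heq⟩, hA, fun B hB => hrisk.trans ?_⟩
  have htwo := (ENNReal.add_le_add_iff_right (measure_ne_top π _)).1 (heq.trans_le (hdual B hB))
  exact (ENNReal.mul_le_mul_iff_right two_ne_zero ENNReal.ofNat_ne_top).1 htwo

theorem densityMeasure_eq_ofReal {f : ℝ → ℝ} (hf : Integrable f) (hf₀ : ∀ x, 0 ≤ f x) {s : Set ℝ}
    (hs : MeasurableSet s) : densityMeasure f s = ENNReal.ofReal (∫ x in s, f x) := by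
  rw [densityMeasure_apply hs,
    ofReal_integral_eq_lintegral_ofReal hf.integrableOn (ae_of_all _ hf₀)]

section Data

variable {w : Fin 2 → ℝ} {ρ : Fin 2 → ℝ → ℝ}

theorem dataMeasure_eq_labelMeasure (hw : ∀ y, 0 ≤ w y) (hρ : ∀ y, Measurable (ρ y)) :
    dataMeasure w ρ = labelMeasure fun y => densityMeasure fun x => w y * ρ y x := by
  refine Finset.sum_congr rfl fun y _ => ?_
  rw [← Measure.map_smul, ← withDensity_smul _ (hρ y).ennreal_ofReal]
  simp only [densityMeasure, Pi.smul_def, smul_eq_mul, ENNReal.ofReal_mul (hw y)]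

theorem densityMeasure_const_mul_eq_ofReal (hw : ∀ y, 0 ≤ w y) (hρ : ∀ y, IsProbDensity (ρ y))
    (y : Fin 2) {s : Set ℝ} (hs : MeasurableSet s) :
    densityMeasure (fun x => w y * ρ y x) s = ENNReal.ofReal (w y * ∫ x in s, ρ y x) := by
  rw [← MeasureTheory.integral_const_mul, densityMeasure_eq_ofReal ((hρ y).integrable.const_mul _)
    (fun x => mul_nonneg (hw y) ((hρ y).nonneg x)) hs]

theorem isProbabilityMeasure_labelMeasure (hw : ∀ y, 0 ≤ w y) (hw_sum : w 0 + w 1 = 1)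
    (hρ : ∀ y, IsProbDensity (ρ y)) :
    IsProbabilityMeasure (labelMeasure fun y => densityMeasure fun x => w y * ρ y x) := by
  have huniv : ∀ y, densityMeasure (fun x => w y * ρ y x) univ = ENNReal.ofReal (w y) := fun y => by
    rw [densityMeasure_const_mul_eq_ofReal hw hρ y MeasurableSet.univ, setIntegral_univ,
      (hρ y).integral_eq_one, mul_one]
  refine ⟨?_⟩
  simp only [labelMeasure_apply, mem_univ, ofPred_true]
  rw [huniv, huniv, ← ENNReal.ofReal_add (hw 0) (hw 1), hw_sum, ENNReal.ofReal_one]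

theorem mul_setIntegral_sub_eq_of_two_mul_add_eq_one (hw : ∀ y, 0 ≤ w y)
    (hw_sum : w 0 + w 1 = 1) (hρ : ∀ y, IsProbDensity (ρ y)) {s t : Set ℝ} (hs : MeasurableSet s)
    (ht : MeasurableSet t) {c : ℝ≥0∞}
    (h : 2 * (densityMeasure (fun x => w 0 * ρ 0 x) s +
      densityMeasure (fun x => w 1 * ρ 1 x) tᶜ) + c = 1) :
    w 1 * (∫ x in t, ρ 1 x) - w 0 * ∫ x in s, ρ 0 x =
      1 / 2 * c.toReal + 1 / 2 * (w 1 - w 0) := by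
  have hnonneg : ∀ y (u : Set ℝ), 0 ≤ w y * ∫ x in u, ρ y x := fun y u =>
    mul_nonneg (hw y) (integral_nonneg (hρ y).nonneg)
  have hc : c ≠ ∞ := ne_top_of_le_ne_top ENNReal.one_ne_top (h ▸ le_add_self)
  have hcompl : ∫ x in tᶜ, ρ 1 x = 1 - ∫ x in t, ρ 1 x := by
    rw [setIntegral_compl ht (hρ 1).integrable, (hρ 1).integral_eq_one]
  rw [densityMeasure_const_mul_eq_ofReal hw hρ 0 hs,
    densityMeasure_const_mul_eq_ofReal hw hρ 1 ht.compl,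
    ← ENNReal.ofReal_add (hnonneg 0 s) (hnonneg 1 tᶜ), hcompl] at h
  have hreal := congrArg ENNReal.toReal h
  rw [ENNReal.toReal_add (by finiteness) hc, ENNReal.toReal_mul, ENNReal.toReal_ofNat,
    ENNReal.toReal_ofReal (hcompl ▸ add_nonneg (hnonneg 0 s) (hnonneg 1 tᶜ)),
    ENNReal.toReal_one] at hreal
  linarith

theorem exists_coupling_integral_eq_and_isRobustOptimal_of_matching (hw : ∀ y, 0 ≤ w y)
    (hw_sum : w 0 + w 1 = 1) (hρ : ∀ y, IsProbDensity (ρ y)) (hm : ∀ y, Measurable (ρ y))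
    {ε : ℝ} (hε : 0 ≤ ε) {A : Set ℝ} (hA : MeasurableSet A) (hfr : volume (frontier A) = 0)
    {σ : Measure (ℝ × ℝ)} (hfst : σ.fst ≤ densityMeasure fun x => w 0 * ρ 0 x)
    (hsnd : σ.snd ≤ densityMeasure fun x => w 1 * ρ 1 x)
    (hdist : ∀ᵐ z ∂σ, dist z.1 z.2 ≤ 2 * ε)
    (hσ : densityMeasure (fun x => w 0 * ρ 0 x) (offsetSet A ε) +
      densityMeasure (fun x => w 1 * ρ 1 x) (offsetSet A (-ε))ᶜ ≤ σ univ) :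
    (∃ π ∈ couplings (dataMeasure w ρ) (swapLabels (dataMeasure w ρ)),
      w 1 * (∫ x in offsetSet A (-ε), ρ 1 x) - w 0 * (∫ x in offsetSet A ε, ρ 0 x)
        = 1 / 2 * (∫ z, transportCost ε z.1 z.2 ∂π) + 1 / 2 * (w 1 - w 0)) ∧
    IsRobustOptimal (dataMeasure w ρ) ε A := by
  have := isProbabilityMeasure_labelMeasure hw hw_sum hρ
  rw [dataMeasure_eq_labelMeasure hw hm]
  obtain ⟨⟨π, hπ, heq⟩, hopt⟩ := exists_coupling_and_isRobustOptimal_of_matching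
    (μ := fun y => densityMeasure fun x => w y * ρ y x)
    (fun y => withDensity_absolutelyContinuous _ _) hε hA hfr hfst hsnd hdist hσ
  refine ⟨⟨π, hπ, ?_⟩, hopt⟩
  rw [integral_transportCost, measureReal_def]
  exact mul_setIntegral_sub_eq_of_two_mul_add_eq_one hw hw_sum hρ
    (isClosed_offsetSet A ε).measurableSet (isClosed_offsetSet A (-ε)).measurableSet heq

theorem isTransversalBayesSet (hρ : ∀ y, Differentiable ℝ (ρ y)) {A : Set ℝ}
    (hA : IsBayesSet w ρ A)
    (hfin : {t : ℝ | w 0 * ρ 0 t = w 1 * ρ 1 t ∧ 0 < w 1 * ρ 1 t}.Finite)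
    (hnd : ∀ t : ℝ, w 0 * ρ 0 t = w 1 * ρ 1 t → 0 < w 1 * ρ 1 t →
      w 0 * deriv (ρ 0) t ≠ w 1 * deriv (ρ 1) t)
    (hpos : ∀ t ∈ frontier A, 0 < w 0 * ρ 0 t + w 1 * ρ 1 t) :
    IsTransversalBayesSet (fun x => w 0 * ρ 0 x) (fun x => w 1 * ρ 1 x) A := by
  have hd : ∀ y, Differentiable ℝ fun x => w y * ρ y x := fun y => (hρ y).const_mul (w y)
  have hcross : ∀ t ∈ frontier A, w 0 * ρ 0 t = w 1 * ρ 1 t ∧ 0 < w 1 * ρ 1 t := fun t ht => by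
    have heq := eq_of_mem_frontier_of_le (hd 0).continuous (hd 1).continuous
      (fun x => (hA x).1) (fun x => (hA x).2) ht
    exact ⟨heq, by linarith [hpos t ht]⟩
  refine ⟨hd 0, hd 1, fun x => (hA x).1, fun x => (hA x).2, hfin.subset hcross, fun t ht => ?_⟩
  simpa only [deriv_const_mul_field] using hnd t (hcross t ht).1 (hcross t ht).2

theorem solvesEvolution_iff {T : ℝ} {K : ℕ} {a₀ b₀ : Fin K → EReal} {a b : Fin K → ℝ → EReal} :
    SolvesEvolution w ρ T a₀ b₀ a b ↔ ∀ i,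
      CrossingEvolves (fun x => w 0 * ρ 0 x) (fun x => w 1 * ρ 1 x) T (a₀ i) (a i) ∧
      CrossingEvolves (fun x => w 1 * ρ 1 x) (fun x => w 0 * ρ 0 x) T (b₀ i) (b i) := by
  simp only [SolvesEvolution, CrossingEvolves, deriv_const_mul_field]

end Data

namespace IsTransversalBayesSet

variable {f g : ℝ → ℝ} {A : Set ℝ} {K : ℕ} {a₀ b₀ : Fin K → EReal}

theorem exists_crossingEvolves_isWindowFamily (h : IsTransversalBayesSet f g A)
    (hB : IsBoundary A a₀ b₀) (hf : ContDiff ℝ 1 f) (hg : ContDiff ℝ 1 g)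
    (hf₀ : ∀ x, 0 ≤ f x) (hg₀ : ∀ x, 0 ≤ g x) :
    ∃ T > 0, (∃ a b : Fin K → ℝ → EReal,
        ∀ i, CrossingEvolves f g T (a₀ i) (a i) ∧ CrossingEvolves g f T (b₀ i) (b i)) ∧
      ∀ a b : Fin K → ℝ → EReal,
        (∀ i, CrossingEvolves f g T (a₀ i) (a i) ∧ CrossingEvolves g f T (b₀ i) (b i)) →
        ∀ ε ∈ Icc 0 T, ∃ δ Ja Jb,
          IsWindowFamily f g δ ε a₀ b₀ (fun i => a i ε) (fun i => b i ε) Ja Jb := by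
  obtain ⟨δ, hab, hba, hδ⟩ := ((eventually_all.2 fun i => eventually_add_two_mul_lt (hB.lt i)).and
    ((eventually_all.2 fun i => eventually_all.2 fun j => eventually_imp_distrib_left.2 fun hij =>
      eventually_add_two_mul_lt (hB.lt_of_lt i j hij)).and self_mem_nhdsWithin)).exists
  obtain ⟨T, hleft, hright, hT⟩ := ((eventually_all.2 fun i => eventually_crossingEvolves hf hg
    hf₀ hg₀ (fun _ => h.crossing_of_left_eq hB (i := i)) hδ).and
    ((eventually_all.2 fun i => eventually_crossingEvolves hg hf hg₀ hf₀
      (fun _ => h.crossing_of_right_eq hB (i := i)) hδ).and self_mem_nhdsWithin)).exists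
  choose a ha using fun i => (hleft i).1
  choose b hb using fun i => (hright i).1
  refine ⟨T, hT, ⟨a, b, fun i => ⟨ha i, hb i⟩⟩, fun a b hsol ε hε => ?_⟩
  choose Ja hJa using fun i => (hleft i).2 (a i) (hsol i).1 ε hε
  choose Jb hJb using fun i => (hright i).2 (b i) (hsol i).2 ε hε
  exact ⟨δ, Ja, Jb, hδ, hJa, hJb, hab, hba⟩

theorem exists_matching (h : IsTransversalBayesSet f g A) (hB : IsBoundary A a₀ b₀) {δ ε : ℝ}
    {a b : Fin K → EReal} {Ja Jb : Fin K → Set ℝ}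
    (hJ : IsWindowFamily f g δ ε a₀ b₀ a b Ja Jb) (hε : 0 ≤ ε) :
    ∃ τ : Measure (ℝ × ℝ), τ.fst ≤ densityMeasure f ∧ τ.snd ≤ densityMeasure g ∧
      (∀ᵐ z ∂τ, dist z.1 z.2 ≤ 2 * ε) ∧
      densityMeasure f (offsetSet (intervalUnion a b) ε) +
        densityMeasure g (offsetSet (intervalUnion a b) (-ε))ᶜ ≤ τ univ := by
  obtain ⟨τ, hfst, hsnd, hdist, hτ⟩ := hJ.exists_matching hε
    (fun x hx => h.le_of_mem x (interior_subset (hB.union_eq ▸ hx)))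
    (fun x hx => h.le_of_notMem_interior (hB.union_eq ▸ hx))
  refine ⟨τ, hfst, hsnd, hdist, le_trans ?_ hτ⟩
  gcongr
  · exact offsetSet_intervalUnion_subset_dilatedIntervals a b hε
  · exact erodedIntervals_subset_offsetSet_neg a b hε

end IsTransversalBayesSet

end AdvClass

end

theorem mainTheorem1 (w : Fin 2 → ℝ) (ρ : Fin 2 → ℝ → ℝ)
    (hw : ∀ y, 0 ≤ w y) (hw_sum : w 0 + w 1 = 1)
    (hρ : ∀ y, IsProbDensity (ρ y))
    (hreg : ∀ y, ContDiff ℝ 1 (ρ y))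
    (hfin : {t : ℝ | w 0 * ρ 0 t = w 1 * ρ 1 t ∧ 0 < w 1 * ρ 1 t}.Finite)
    (hnd : ∀ t : ℝ, w 0 * ρ 0 t = w 1 * ρ 1 t → 0 < w 1 * ρ 1 t →
      w 0 * deriv (ρ 0) t ≠ w 1 * deriv (ρ 1) t)
    (A₀ : Set ℝ) (hA₀ : IsBayesSet w ρ A₀)
    (hpos : ∀ t ∈ frontier A₀, 0 < w 0 * ρ 0 t + w 1 * ρ 1 t) :
    ∃ (K : ℕ) (a₀ b₀ : Fin K → EReal), IsBoundary A₀ a₀ b₀ ∧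
      ∃ ε₀ : ℝ, 0 < ε₀ ∧
        (∃ a b : Fin K → ℝ → EReal, SolvesEvolution w ρ ε₀ a₀ b₀ a b) ∧
        ∀ a b : Fin K → ℝ → EReal, SolvesEvolution w ρ ε₀ a₀ b₀ a b →
          ∀ ε ∈ Set.Icc (0 : ℝ) ε₀,
            (∃ π ∈ couplings (dataMeasure w ρ) (swapLabels (dataMeasure w ρ)),
              w 1 * (∫ x in offsetSet (intervalUnion (fun i => a i ε) (fun i => b i ε)) (-ε),
                  ρ 1 x)
                - w 0 * (∫ x in offsetSet (intervalUnion (fun i => a i ε) (fun i => b i ε)) ε,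
                  ρ 0 x)
              = 1 / 2 * (∫ z, transportCost ε z.1 z.2 ∂π) + 1 / 2 * (w 1 - w 0)) ∧
            IsRobustOptimal (dataMeasure w ρ) ε
              (intervalUnion (fun i => a i ε) (fun i => b i ε)) := by
  have hC : ∀ y, ContDiff ℝ 1 fun x => w y * ρ y x := fun y => contDiff_const.mul (hreg y)
  have hnonneg : ∀ y x, 0 ≤ w y * ρ y x := fun y x => mul_nonneg (hw y) ((hρ y).nonneg x)
  have hbayes := isTransversalBayesSet (fun y => (hreg y).differentiable one_ne_zero) hA₀ hfin hnd
    hpos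
  obtain ⟨K, a₀, b₀, hB⟩ := hbayes.exists_isBoundary
  obtain ⟨T, hT, ⟨a, b, hab⟩, hwindow⟩ := hbayes.exists_crossingEvolves_isWindowFamily hB
    (hC 0) (hC 1) (hnonneg 0) (hnonneg 1)
  refine ⟨K, a₀, b₀, hB, T, hT, ⟨a, b, solvesEvolution_iff.2 hab⟩, fun a b hsol ε hε => ?_⟩
  obtain ⟨δ, Ja, Jb, hJ⟩ := hwindow a b (solvesEvolution_iff.1 hsol) ε hε
  obtain ⟨τ, hfst, hsnd, hdist, hτ⟩ := hbayes.exists_matching hB hJ hε.1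
  exact exists_coupling_integral_eq_and_isRobustOptimal_of_matching hw hw_sum hρ
    (fun y => (hreg y).continuous.measurable) hε.1 (isOpen_intervalUnion _ _).measurableSet
    ((finite_frontier_intervalUnion _ _).measure_zero volume) hfst hsnd hdist hτ
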